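/- **Setting.** Let $\mathbb{F}_q$ be a finite field, let $f\in\mathbb{F}_q[\theta]$ be monic and irreducible, $\mathbb{F}_f=\mathbb{F}_q[\theta]/(f)$, let $\bar\theta\in\mathbb{F}_f$ be a root of $f$ (e.g. the class of $\theta$), and let $\overline{\mathbb{F}}_f$ be an algebraic closure of $\mathbb{F}_f$. Let $Z=\{z_1,\dots,z_n\}$, $n\ge 0$, be variables. For a field $F$ let $F\langle Z\rangle$ denote either the field of rational functions $F(Z)$ or the field of formal Laurent series $F((Z))$ (for $n\geq 2$ the latter may be read as the fraction field of $F[[Z]]$ or as the field of iterated Laurent series; the choice is the same for all $F$). Put $k=\mathbb{F}_q\langle Z\rangle$, $H_0=\mathbb{F}_f\langle Z\rangle$, $H=\overline{\mathbb{F}}_f\langle Z\rangle$ and $\mathcal{A}=k[t]$. Let $\tau$ be the automorphism of $H$ (and of $H_0$) that raises coefficients to the $q$-th power and fixes the variables, $\sigma=\tau^{-1}$, and let $H[\tau]$, $H[\sigma]$ be the twisted polynomial rings ($\tau c=\tau(c)\tau$, $\sigma c=\sigma(c)\sigma$). For a matrix $\eta=\sum_i N_i\tau^i$ over $H[\tau]$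 put $\eta^*=\sum_i \sigma^i(N_i)^{\mathsf T}\sigma^i$. Such matrices act on column vectors over $H$ through the action of $\tau$ and $\sigma$ on $H$. An *Anderson $t$-module* of dimension $\ell$ over $H_0$ is a $k$-algebra homomorphism $\mathcal{E}:\mathcal{A}\to \mathrm{Mat}_\ell(H_0[\tau])$, $a\mapsto\mathcal{E}_a$, such that $\partial\mathcal{E}_t-\bar\theta\,\mathrm{I}_\ell$ is nilpotent, where $\partial\mathcal{E}_t$ is the constant term of $\mathcal{E}_t$. Its adjoint is $\mathcal{E}^*:\mathcal{A}\to\mathrm{Mat}_\ell(H[\sigma])$, $\mathcal{E}^*_a=(\mathcal{E}_a)^*$. For $\nu\in\mathcal{A}$ put $\mathcal{E}[\nu]=\{\mathbf{x}\in H^\ell:\mathcal{E}_\nu(\mathbf{x})=0\}$ and $\mathcal{E}^*[\nu]=\{\mathbf{y}\in H^\ell:\mathcal{E}^*_\nu(\mathbf{y})=0\}$; these are $\mathcal{A}$-modules through $\mathcal{E}$, resp. $\mathcal{E}^*$. For $\mathbf{x}\in\mathcal{E}[\nu]$ there is a unique row vector $g_{\mathbf{x}}$ over $H[\sigma]$ with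 $\mathbf{x}^{\mathsf T}(\mathcal{E}_\nu)^*=(1-\sigma)g_{\mathbf{x}}$, and the Poonen pairing is $\langle\mathbf{x},\mathbf{y}\rangle_\nu=g_{\mathbf{x}}(\mathbf{y})\in H$ for $\mathbf{y}\in\mathcal{E}^*[\nu]$. Let $\lambda\in\mathbb{F}_q[t]$ be monic and irreducible with $\lambda(\theta)\ne f$. Put $\mathcal{A}_\lambda=\varprojlim\mathcal{A}/\lambda^m\mathcal{A}$, $T_\lambda(\mathcal{E})=\varprojlim\mathcal{E}[\lambda^m]$ and $T_\lambda(\mathcal{E}^*)=\varprojlim\mathcal{E}^*[\lambda^m]$, the last two along multiplication by $\lambda$. These are $\mathcal{A}_\lambda$-modules, with the inverse limit topologies of discrete modules, and $\mathrm{Gal}(\overline{\mathbb{F}}_f/\mathbb{F}_f)$ acts on $T_\lambda(\mathcal{E})$ and $T_\lambda(\mathcal{E}^*)$ through the coefficients of elements of $H$. Let $(\mathcal{A}/\lambda^m\mathcal{A})^\wedge$ be the $k$-dual of $\mathcal{A}/\lambda^m\mathcal{A}$, with the $\mathcal{A}$-module structure $(a u)(b)=u(ab)$, and let $W_\lambda=\varprojlim(\mathcal{A}/\lambda^m\mathcal{A})^\wedge$,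 along multiplication by $\lambda$. Consider the following conditions, for some $r\geq 0$: (a) $\mathrm{Mat}_{1\times\ell}(H[\tau])$, as a left $H[t]$-module with $t\cdot m=m\,\mathcal{E}_t$, is free of rank $r$; (b) $\mathrm{Mat}_{1\times\ell}(H[\sigma])$, as a left $H[t]$-module with $t\cdot m=m\,\mathcal{E}^*_t$, is free of the same rank $r$; (c) for every $m\ge1$, $\mathcal{E}[\lambda^m]$ and $\mathcal{E}^*[\lambda^m]$ have full dimension, that is, their $k$-dimensions both equal $\sum_i\deg_\tau d_i$, where $\mathrm{diag}(d_1,\dots,d_\ell)=U\mathcal{E}_{\lambda^m}V$ for some $U,V\in\mathrm{GL}_\ell(H[\tau])$. **Theorem.** The $\mathcal{A}_\lambda$-modules $W_\lambda$ and $\mathcal{A}_\lambda$ are isomorphic. For every isomorphism of $\mathcal{A}_\lambda$-modules $\Theta:W_\lambda\to\mathcal{A}_\lambda$, the Poonen pairings induce a well-defined, continuous, $\mathcal{A}_\lambda$-bilinear pairing $$[\cdot,\cdot]_\lambda:T_\lambda(\mathcal{E})\times T_\lambda(\mathcal{E}^*)\to\mathcal{A}_\lambda,\qquad [(\mathbf{x}_m)_m,(\mathbf{y}_m)_m]_\lambda=\Theta\Bigl(\bigl(a\mapsto\langle\mathcal{E}_a(\mathbf{x}_m),\mathbf{y}_m\rangle_{\lambda^m}\bigr)_m\Bigr).$$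 In particular, the functions $a\mapsto\langle\mathcal{E}_a(\mathbf{x}_m),\mathbf{y}_m\rangle_{\lambda^m}$ have values in $k$ and form an element of $W_\lambda$. The pairing has the following properties. 1. It is $\mathrm{Gal}(\overline{\mathbb{F}}_f/\mathbb{F}_f)$-equivariant, with the trivial action on $\mathcal{A}_\lambda$: $[\gamma\mathbf{x},\gamma\mathbf{y}]_\lambda=[\mathbf{x},\mathbf{y}]_\lambda$ for all $\gamma$. 2. If (a)–(c) hold, then it is non-degenerate: both of its kernels are trivial, and it is even perfect, that is, it identifies each of $T_\lambda(\mathcal{E})$ and $T_\lambda(\mathcal{E}^*)$ with the $\mathcal{A}_\lambda$-dual of the other. -/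

import Mathlib

open scoped Polynomial

noncomputable section

/-! ### Generalities on Tate modules -/

/-- For a module `M` over a commutative ring `A` and `l ∈ A`, the inverse limit of the torsion
submodules `M[l ^ m]` along multiplication by `l : M[l ^ (m + 1)] → M[l ^ m]`. -/
def TateModule {A : Type*} [CommRing A] (l : A) (M : Type*) [AddCommGroup M] [Module A M] :
    Submodule A (ℕ → M) where
  carrier := {x | (∀ m, l ^ m • x m = 0) ∧ ∀ m, l • x (m + 1) = x m}
  add_mem' := by
    rintro x y ⟨hx, hx'⟩ ⟨hy, hy'⟩
    exact ⟨fun m => by simp [hx, hy], fun m => by simp [hx', hy']⟩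
  zero_mem' := by simp
  smul_mem' := by
    rintro a x ⟨hx, hx'⟩
    exact ⟨fun m => by simp [smul_comm _ a, hx], fun m => by simp [smul_comm _ a, hx']⟩

/-- The completion of `A` at the principal ideal `(l)`. -/
abbrev AdicRing {A : Type*} [CommRing A] (l : A) : Type _ := AdicCompletion (Ideal.span {l}) A

namespace TateModule

variable {A : Type*} [CommRing A] {l : A} {M N : Type*} [AddCommGroup M] [Module A M]
  [AddCommGroup N] [Module A N]

/-- The projection from the Tate module to the `l ^ m`-torsion. -/
def proj (m : ℕ) : TateModule l M →ₗ[A] Submodule.torsionBy A M (l ^ m) where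
  toFun x := ⟨x.1 m, x.2.1 m⟩
  map_add' _ _ := rfl
  map_smul' _ _ := rfl

/-- An element of `A` that represents the image of `a ∈ A_l` in `A / l ^ m`. -/
def rep (a : AdicRing l) (m : ℕ) : A := (Ideal.Quotient.mk_surjective (AdicCompletion.evalₐ _ m a)).choose

lemma mk_rep (a : AdicRing l) (m : ℕ) :
    Ideal.Quotient.mk (Ideal.span {l} ^ m) (rep a m) = AdicCompletion.evalₐ _ m a :=
  (Ideal.Quotient.mk_surjective (AdicCompletion.evalₐ _ m a)).choose_spec

lemma smul_eq_of_mk_eq {m : ℕ} {r s : A} {x : M} (hx : l ^ m • x = 0)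
    (h : Ideal.Quotient.mk (Ideal.span {l} ^ m) r = Ideal.Quotient.mk (Ideal.span {l} ^ m) s) :
    r • x = s • x := by
  rw [Ideal.Quotient.eq, Ideal.span_singleton_pow, Ideal.mem_span_singleton] at h
  obtain ⟨c, hc⟩ := h
  rw [← sub_eq_zero, ← sub_smul, hc, mul_comm, mul_smul, hx, smul_zero]

lemma mk_rep_succ (a : AdicRing l) (m : ℕ) :
    Ideal.Quotient.mk (Ideal.span {l} ^ m) (rep a (m + 1)) =
      Ideal.Quotient.mk (Ideal.span {l} ^ m) (rep a m) := by
  have h := mk_rep a (m + 1)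
  have h' := mk_rep a m
  revert h h'
  generalize rep a (m + 1) = r
  generalize rep a m = s
  induction a using AdicCompletion.induction_on with
  | h x =>
    rw [AdicCompletion.evalₐ_mk, AdicCompletion.evalₐ_mk]
    intro h h'
    refine Eq.trans ?_ ((AdicCompletion.Ideal.mk_eq_mk _ (Nat.le_succ m) x).trans h'.symm)
    rw [Ideal.Quotient.eq]
    exact Ideal.pow_le_pow_right (Nat.le_succ m) (Ideal.Quotient.eq.mp h)

/-- The `A_l`-module structure on the Tate module: `a` acts on the `m`-th component, which is
`l ^ m`-torsion, through its class in `A / l ^ m`. -/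
instance : Module (AdicRing l) (TateModule l M) where
  smul a x := ⟨fun m => rep a m • x.1 m, fun m => by rw [smul_comm, x.2.1, smul_zero], fun m => by
    rw [smul_comm, x.2.2]; exact smul_eq_of_mk_eq (x.2.1 m) (mk_rep_succ a m)⟩
  one_smul x := Subtype.ext <| funext fun m => by
    change rep 1 m • x.1 m = x.1 m
    rw [smul_eq_of_mk_eq (x.2.1 m) (s := 1) (by rw [mk_rep]; simp), one_smul]
  mul_smul a b x := Subtype.ext <| funext fun m => by
    change rep (a * b) m • x.1 m = rep a m • rep b m • x.1 m
    rw [smul_smul]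
    exact smul_eq_of_mk_eq (x.2.1 m) (by simp [mk_rep])
  smul_zero a := Subtype.ext <| funext fun m => smul_zero _
  smul_add a x y := Subtype.ext <| funext fun m => smul_add _ _ _
  add_smul a b x := Subtype.ext <| funext fun m => by
    change rep (a + b) m • x.1 m = rep a m • x.1 m + rep b m • x.1 m
    rw [← add_smul]
    exact smul_eq_of_mk_eq (x.2.1 m) (by simp [mk_rep])
  zero_smul x := Subtype.ext <| funext fun m => by
    change rep 0 m • x.1 m = 0
    rw [smul_eq_of_mk_eq (x.2.1 m) (s := 0) (by rw [mk_rep]; simp), zero_smul]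

/-- The inverse limit topology, each `M[l ^ m]` being discrete. -/
instance : TopologicalSpace (TateModule l M) :=
  TopologicalSpace.induced Subtype.val (@Pi.topologicalSpace ℕ (fun _ => M) fun _ => ⊥)

/-- A homomorphism of `A`-modules acts on Tate modules componentwise. -/
def map (F : M →ₗ[A] N) : TateModule l M →ₗ[A] TateModule l N where
  toFun x := ⟨fun m => F (x.1 m), fun m => by rw [← map_smul, x.2.1, map_zero], fun m => by
    rw [← map_smul, x.2.2]⟩
  map_add' x y := Subtype.ext <| funext fun m => map_add F _ _
  map_smul' a x := Subtype.ext <| funext fun m => map_smul F _ _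

end TateModule

/-- The `l`-adic topology on the completion: the inverse limit topology, each `A / l ^ m` being
discrete. -/
instance AdicRing.instTopologicalSpace {A : Type*} [CommRing A] (l : A) :
    TopologicalSpace (AdicRing l) :=
  ⨅ m : ℕ, TopologicalSpace.induced (AdicCompletion.evalₐ (Ideal.span {l}) m) ⊥

/-- The `k`-dual of `k[t]`. For `l ∈ k[t]`, its `l ^ m`-torsion is the dual of `k[t] / (l ^ m)`, and
its Tate module is the inverse limit of these duals along multiplication by `l`. -/
def PolyDual (k : Type*) [Field k] : Type _ := k[X] →ₗ[k] k

namespace PolyDual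

variable {k : Type*} [Field k]

instance : AddCommGroup (PolyDual k) := inferInstanceAs (AddCommGroup (k[X] →ₗ[k] k))

instance : FunLike (PolyDual k) k[X] k := inferInstanceAs (FunLike (k[X] →ₗ[k] k) k[X] k)

/-- The `k[t]`-module structure `(a • u) b = u (a * b)`. -/
instance : Module k[X] (PolyDual k) where
  smul a u := (show k[X] →ₗ[k] k from u).comp (LinearMap.mulLeft k a)
  one_smul u := LinearMap.ext fun b => congrArg (show k[X] →ₗ[k] k from u) (one_mul b)
  mul_smul a a' u := LinearMap.ext fun b => congrArg (show k[X] →ₗ[k] k from u) (by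
    change a * a' * b = a' * (a * b); ring)
  smul_zero a := rfl
  smul_add a u v := rfl
  add_smul a a' u := LinearMap.ext fun b => by
    change (show k[X] →ₗ[k] k from u) ((a + a') * b) = _
    rw [add_mul, map_add]; rfl
  zero_smul u := LinearMap.ext fun b => by
    change (show k[X] →ₗ[k] k from u) (0 * b) = _
    rw [zero_mul, map_zero]; rfl

end PolyDual

/-! ### Twisted polynomials -/

section Twisted

variable {k H H' : Type*} [Field k] [Field H] [Algebra k H] [Field H'] [Algebra k H']

/-- The field `H`, remembering the automorphism `φ` by which polynomials in one variable over it
are going to be twisted. -/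
def Tw (_φ : H ≃ₐ[k] H) : Type _ := H

namespace Tw

variable (φ : H ≃ₐ[k] H)

instance : Field (Tw φ) := inferInstanceAs (Field H)

instance : Algebra k (Tw φ) := inferInstanceAs (Algebra k H)

/-- The identity map from `H` to `Tw φ`. -/
def of : H ≃ₐ[k] Tw φ := (AlgEquiv.refl : H ≃ₐ[k] H)

variable {φ} in
/-- The identity map from `Tw φ` to `H`. -/
def val : Tw φ ≃ₐ[k] H := (AlgEquiv.refl : H ≃ₐ[k] H)

@[simp] lemma val_of (x : H) : val (of φ x) = x := rfl

@[simp] lemma of_val (x : Tw φ) : of φ (val x) = x := rfl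

/-- The natural number `n` acts as `φ ^ n`. -/
instance : MulSemiringAction (Multiplicative ℕ) (Tw φ) where
  smul n x := (φ ^ n.toAdd : H ≃ₐ[k] H) x
  one_smul x := rfl
  mul_smul m n x := by
    change (φ ^ (m.toAdd + n.toAdd) : H ≃ₐ[k] H) x = _
    rw [pow_add]; rfl
  smul_zero n := map_zero (φ ^ n.toAdd : H ≃ₐ[k] H)
  smul_add n := map_add (φ ^ n.toAdd : H ≃ₐ[k] H)
  smul_one n := map_one (φ ^ n.toAdd : H ≃ₐ[k] H)
  smul_mul n := map_mul (φ ^ n.toAdd : H ≃ₐ[k] H)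

instance : SMulCommClass (Multiplicative ℕ) k (Tw φ) where
  smul_comm n c x := map_smul (φ ^ n.toAdd : H ≃ₐ[k] H) c x

end Tw

/-- The ring `H[φ]` of twisted polynomials `∑ aᵢ φ ^ i`, with `φ * a = φ(a) * φ`. -/
abbrev TwPoly (φ : H ≃ₐ[k] H) : Type _ := SkewPolynomial (Tw φ)

namespace TwPoly

open SkewPolynomial

variable {φ : H ≃ₐ[k] H} {φ' : H' ≃ₐ[k] H'}

/-- The degree of a twisted polynomial (`0` for the zero polynomial). -/
def deg (p : TwPoly φ) : ℕ := p.support.sup id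

lemma sum_add {S : Type*} [AddCommMonoid S] (p q : TwPoly φ) (h : ℕ → Tw φ → S)
    (h0 : ∀ n, h n 0 = 0) (hadd : ∀ n a b, h n (a + b) = h n a + h n b) :
    (p + q).sum h = p.sum h + q.sum h :=
  SkewMonoidAlgebra.sum_add_index' (fun _ => h0 _) (fun _ => hadd _)

lemma induct {P : TwPoly φ → Prop} (p : TwPoly φ) (h1 : ∀ n a, P (monomial n a))
    (h2 : ∀ p q, P p → P q → P (p + q)) : P p :=
  SkewMonoidAlgebra.induction_on' p (fun n a => h1 n.toAdd a) h2

lemma monomial_mul (n m : ℕ) (a b : Tw φ) :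
    monomial n a * monomial m b =
      monomial (n + m) (a * Tw.of φ ((φ ^ n : H ≃ₐ[k] H) (Tw.val b))) := by
  rw [monomial_mul_monomial, φ_iterate_apply]; rfl

/-- The value `p(x) = ∑ aᵢ φ ^ i (x)` for `p = ∑ aᵢ φ ^ i`. -/
def eval (p : TwPoly φ) (x : H) : H :=
  p.sum fun n a => Tw.val a * (φ ^ n : H ≃ₐ[k] H) x

lemma eval_monomial (n : ℕ) (a : Tw φ) (x : H) :
    eval (monomial n a) x = Tw.val a * (φ ^ n : H ≃ₐ[k] H) x :=
  sum_monomial_index (by simp)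

lemma eval_add (p q : TwPoly φ) (x : H) : eval (p + q) x = eval p x + eval q x :=
  sum_add p q _ (by simp) (by simp [add_mul])

lemma eval_zero (x : H) : eval (0 : TwPoly φ) x = 0 := by
  simpa using eval_add (0 : TwPoly φ) 0 x

lemma eval_one (x : H) : eval (1 : TwPoly φ) x = x := by
  rw [← monomial_zero_one, eval_monomial]; exact one_mul x

lemma eval_add_right (p : TwPoly φ) (x y : H) : eval p (x + y) = eval p x + eval p y := by
  induction p using induct with
  | h1 n a => simp only [eval_monomial, map_add, mul_add]
  | h2 p q hp hq => rw [eval_add, eval_add, eval_add, hp, hq]; abel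

lemma eval_smul_right (p : TwPoly φ) (c : k) (x : H) : eval p (c • x) = c • eval p x := by
  induction p using induct with
  | h1 n a => simp only [eval_monomial, map_smul, mul_smul_comm]
  | h2 p q hp hq => rw [eval_add, eval_add, hp, hq, smul_add]

/-- Evaluation at elements of `H`, as a ring homomorphism to the `k`-linear endomorphisms. -/
def evalHom (φ : H ≃ₐ[k] H) : TwPoly φ →+* Module.End k H where
  toFun p :=
    { toFun := eval p
      map_add' := eval_add_right p
      map_smul' := eval_smul_right p }
  map_one' := LinearMap.ext fun x => eval_one (φ := φ) x
  map_zero' := LinearMap.ext fun x => eval_zero (φ := φ) x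
  map_add' p q := LinearMap.ext (eval_add p q)
  map_mul' p q := LinearMap.ext fun x => by
    change eval (p * q) x = eval p (eval q x)
    induction p using induct with
    | h2 p p' hp hp' => rw [add_mul, eval_add, eval_add, hp, hp']
    | h1 n a =>
      induction q using induct with
      | h2 q q' hq hq' => rw [mul_add, eval_add, eval_add, eval_add_right, hq, hq']
      | h1 m b =>
        rw [monomial_mul, eval_monomial, eval_monomial, eval_monomial, map_mul, pow_add,
          Tw.val_of, map_mul, ← mul_assoc]
        rfl

/-- Apply a homomorphism that commutes with the twists to the coefficients. -/
def map (j : H →ₐ[k] H') (hj : ∀ x, j (φ x) = φ' (j x)) : TwPoly φ →+* TwPoly φ' :=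
  have add (p q : TwPoly φ) :
      ((p + q).sum fun n a => monomial n (Tw.of φ' (j (Tw.val a)))) =
      (p.sum fun n a => monomial n (Tw.of φ' (j (Tw.val a)))) +
      (q.sum fun n a => monomial n (Tw.of φ' (j (Tw.val a)))) :=
    sum_add p q _ (by simp) (by simp)
  have mon (n : ℕ) (a : Tw φ) :
      ((monomial n a : TwPoly φ).sum fun n a => monomial n (Tw.of φ' (j (Tw.val a)))) =
      monomial n (Tw.of φ' (j (Tw.val a))) :=
    sum_monomial_index (by simp)
  { toFun := fun p => p.sum fun n a => monomial n (Tw.of φ' (j (Tw.val a)))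
    map_one' := by
      rw [← monomial_zero_one, mon]; simp [C_1]
    map_zero' := by simp
    map_add' := add
    map_mul' := fun p q => by
      have hpow (n : ℕ) (x : H) : j ((φ ^ n : H ≃ₐ[k] H) x) = (φ' ^ n : H' ≃ₐ[k] H') (j x) := by
        induction n with
        | zero => rfl
        | succ n ih =>
          rw [pow_succ', pow_succ']
          exact (hj _).trans (congrArg φ' ih)
      induction p using induct with
      | h2 p p' hp hp' => rw [add_mul, add, add, add_mul, hp, hp']
      | h1 n a =>
        induction q using induct with
        | h2 q q' hq hq' => rw [mul_add, add, add, mul_add, hq, hq']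
        | h1 m b =>
          rw [monomial_mul, mon, mon, mon, monomial_mul]
          simp only [map_mul, Tw.val_of, hpow] }

/-- The Ore anti-involution `∑ bᵢ τ ^ i ↦ ∑ τ ^ (-i) (bᵢ) σ ^ i`, where `σ = τ⁻¹`. -/
def star (p : TwPoly φ) : TwPoly φ.symm :=
  p.sum fun n a => monomial n (Tw.of φ.symm ((φ.symm ^ n : H ≃ₐ[k] H) (Tw.val a)))

lemma star_monomial (n : ℕ) (a : Tw φ) : star (monomial n a : TwPoly φ) =
    monomial n (Tw.of φ.symm ((φ.symm ^ n : H ≃ₐ[k] H) (Tw.val a))) :=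
  sum_monomial_index (by simp)

lemma star_add (p q : TwPoly φ) : star (p + q) = star p + star q :=
  sum_add p q _ (by simp) (by simp)

lemma star_zero : star (0 : TwPoly φ) = 0 := by
  simpa using star_add (0 : TwPoly φ) 0

lemma star_one : star (1 : TwPoly φ) = 1 := by
  rw [← monomial_zero_one, star_monomial]; simp [C_1]

lemma symm_pow_pow (n : ℕ) (x : H) : (φ.symm ^ n : H ≃ₐ[k] H) ((φ ^ n : H ≃ₐ[k] H) x) = x := by
  have : (φ.symm ^ n : H ≃ₐ[k] H) * φ ^ n = 1 := by
    rw [show φ.symm = φ⁻¹ from rfl, inv_pow, inv_mul_cancel]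
  exact congrArg (fun g : H ≃ₐ[k] H => g x) this

lemma star_mul (p q : TwPoly φ) : star (p * q) = star q * star p := by
  induction p using induct with
  | h2 p p' hp hp' => rw [add_mul, star_add, star_add, mul_add, hp, hp']
  | h1 n a =>
    induction q using induct with
    | h2 q q' hq hq' => rw [mul_add, star_add, star_add, add_mul, hq, hq']
    | h1 m b =>
      rw [monomial_mul, star_monomial, star_monomial, star_monomial, monomial_mul, add_comm n m]
      refine congrArg (monomial (m + n)) ?_
      change (φ.symm ^ (m + n) : H ≃ₐ[k] H) (Tw.val a * (φ ^ n : H ≃ₐ[k] H) (Tw.val b))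
        = (φ.symm ^ m : H ≃ₐ[k] H) (Tw.val b) *
          (φ.symm ^ m : H ≃ₐ[k] H) ((φ.symm ^ n : H ≃ₐ[k] H) (Tw.val a))
      rw [map_mul, pow_add]
      change (φ.symm ^ m : H ≃ₐ[k] H) ((φ.symm ^ n : H ≃ₐ[k] H) _) *
        (φ.symm ^ m : H ≃ₐ[k] H) ((φ.symm ^ n : H ≃ₐ[k] H) _) = _
      rw [symm_pow_pow, mul_comm]

lemma smul_mul (c : Tw φ) (p q : TwPoly φ) : (c • p) * q = c • (p * q) := by
  have h (r : TwPoly φ) : c • r = C c * r := by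
    induction r using induct with
    | h1 n a => rw [smul_monomial, C_mul_monomial, smul_eq_mul]
    | h2 r r' h h' => rw [smul_add, h, h', mul_add]
  rw [h, h, mul_assoc]

lemma coeff_add' (p q : TwPoly φ) (n : ℕ) : (p + q).coeff n = p.coeff n + q.coeff n :=
  by
  simp [SkewPolynomial.coeff]

lemma map_eval (Γ : H →ₐ[k] H) (hφ : ∀ x, Γ (φ x) = φ (Γ x)) (p : TwPoly φ)
    (hp : ∀ n, Γ (Tw.val (p.coeff n)) = Tw.val (p.coeff n)) (x : H) :
    Γ (eval p x) = eval p (Γ x) := by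
  have hpow (n : ℕ) (x : H) : Γ ((φ ^ n : H ≃ₐ[k] H) x) = (φ ^ n : H ≃ₐ[k] H) (Γ x) := by
    induction n with
    | zero => rfl
    | succ n ih =>
      rw [pow_succ']
      exact (hφ _).trans (congrArg φ ih)
  simp only [eval, sum_def, map_sum, map_mul, hp, hpow]

lemma coeff_map (j : H →ₐ[k] H') (hj : ∀ x, j (φ x) = φ' (j x)) (p : TwPoly φ) (n : ℕ) :
    (map j hj p).coeff n = Tw.of φ' (j (Tw.val (p.coeff n))) := by
  induction p using induct with
  | h1 m a =>
    have : map j hj (monomial m a) = monomial m (Tw.of φ' (j (Tw.val a))) := by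
      change SkewPolynomial.sum (monomial m a)
        (fun n a => monomial n (Tw.of φ' (j (Tw.val a)))) = _
      exact sum_monomial_index (by simp)
    rw [this, coeff_monomial, coeff_monomial]
    split_ifs <;> simp
  | h2 p q hp hq => rw [map_add, coeff_add', hp, hq, coeff_add', map_add, map_add, map_add]

lemma coeff_star (p : TwPoly φ) (n : ℕ) : (star p).coeff n =
    Tw.of φ.symm ((φ.symm ^ n : H ≃ₐ[k] H) (Tw.val (p.coeff n))) := by
  induction p using induct with
  | h1 m a =>
    rw [star_monomial, coeff_monomial, coeff_monomial]
    split_ifs with h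
    · rw [h]
    · simp
  | h2 p q hp hq => rw [star_add, coeff_add', hp, hq, coeff_add', map_add, map_add, map_add]

lemma coeff_X_mul_zero (p : TwPoly φ) : (X * p).coeff 0 = 0 := by
  induction p using induct with
  | h1 n a => rw [X_mul_monomial, coeff_monomial_succ]
  | h2 p q hp hq => rw [mul_add, coeff_add', hp, hq, add_zero]

lemma coeff_X_mul_succ (p : TwPoly φ) (n : ℕ) :
    (X * p).coeff (n + 1) = Tw.of φ (φ (Tw.val (p.coeff n))) := by
  induction p using induct with
  | h1 m a =>
    rw [X_mul_monomial, coeff_monomial, coeff_monomial]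
    by_cases h : m = n
    · subst h; simp only [if_true]; rfl
    · rw [if_neg (by omega), if_neg h]; simp
  | h2 p q hp hq => rw [mul_add, coeff_add', hp, hq, coeff_add', map_add, map_add, map_add]

/-- The map `∑ aᵢ σ ^ i ↦ ∑ τ ^ i (aᵢ)` on `H[σ]`, where `σ = τ⁻¹`. -/
def delta (p : TwPoly φ.symm) : H := p.sum fun n a => (φ ^ n : H ≃ₐ[k] H) (Tw.val a)

lemma delta_monomial (n : ℕ) (a : Tw φ.symm) :
    delta (monomial n a) = (φ ^ n : H ≃ₐ[k] H) (Tw.val a) :=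
  sum_monomial_index (by simp)

lemma delta_add (p q : TwPoly φ.symm) : delta (p + q) = delta p + delta q :=
  sum_add p q _ (by simp) (by simp)

lemma exists_division (p : TwPoly φ.symm) :
    ∃ g, p = (1 - X) * g + C (Tw.of φ.symm (delta p)) := by
  induction p using induct with
  | h1 n a =>
    induction n generalizing a with
    | zero => exact ⟨0, by rw [delta_monomial, mul_zero, zero_add]; rfl⟩
    | succ n ih =>
      obtain ⟨g, hg⟩ := ih (Tw.of φ.symm (φ (Tw.val a)))
      have h : monomial (n + 1) a = X * monomial n (Tw.of φ.symm (φ (Tw.val a))) := by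
        rw [X_mul_monomial]
        exact congrArg (monomial (n + 1)) (φ.symm_apply_apply (Tw.val a)).symm
      have hd : delta (monomial (n + 1) a) =
          delta (monomial n (Tw.of φ.symm (φ (Tw.val a)))) := by
        rw [delta_monomial, delta_monomial, pow_succ]; rfl
      refine ⟨g - monomial n (Tw.of φ.symm (φ (Tw.val a))), ?_⟩
      rw [hd, mul_sub, sub_add_eq_add_sub, ← hg, h]
      noncomm_ring
  | h2 p q hp hq =>
    obtain ⟨g, hg⟩ := hp
    obtain ⟨g', hg'⟩ := hq
    refine ⟨g + g', ?_⟩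
    conv_lhs => rw [hg, hg']
    rw [delta_add, map_add, C_add, mul_add]
    abel

lemma eq_zero_of_one_sub_X_mul (g : TwPoly φ) (h : (1 - X) * g = 0) : g = 0 := by
  rw [sub_mul, one_mul, sub_eq_zero] at h
  ext n
  rw [coeff_zero]
  induction n with
  | zero => rw [h, coeff_X_mul_zero]
  | succ n ih => rw [h, coeff_X_mul_succ, ih]; simp

lemma delta_C_mul_star (a : H) (b : TwPoly φ) :
    delta (C (Tw.of φ.symm a) * star b) = eval b a := by
  induction b using induct with
  | h1 n b =>
    rw [star_monomial, C_mul_monomial, delta_monomial, eval_monomial, map_mul, map_mul,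
      Tw.val_of, Tw.val_of, mul_comm]
    have := symm_pow_pow (φ := φ.symm) n (Tw.val b)
    rw [AlgEquiv.symm_symm] at this
    rw [this]
  | h2 p q hp hq => rw [star_add, mul_add, delta_add, hp, hq, eval_add]

end TwPoly

/-! ### Matrices of twisted polynomials -/

namespace TwMat

variable {l : ℕ} {φ : H ≃ₐ[k] H}

/-- The ring `Mat_l(H[φ])`, acting on `H ^ l` by `(B(x))_i = ∑ j, B_{ij}(x_j)`. -/
def evalHom (l : ℕ) (φ : H ≃ₐ[k] H) :
    Matrix (Fin l) (Fin l) (TwPoly φ) →+* Module.End k (Fin l → H) where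
  toFun B := LinearMap.pi fun i => ∑ j, (TwPoly.evalHom φ (B i j)).comp (LinearMap.proj j)
  map_one' := LinearMap.ext fun x => funext fun i => by
    rw [LinearMap.pi_apply, LinearMap.sum_apply, Finset.sum_eq_single i]
    · simp
    · intro j _ hj
      simp [Matrix.one_apply_ne hj.symm]
    · simp
  map_zero' := LinearMap.ext fun x => funext fun i => by simp
  map_add' B C := LinearMap.ext fun x => funext fun i => by
    simp [LinearMap.sum_apply, Finset.sum_add_distrib]
  map_mul' B C := LinearMap.ext fun x => funext fun i => by
    simp only [LinearMap.pi_apply, LinearMap.sum_apply, LinearMap.comp_apply, LinearMap.proj_apply,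
      Matrix.mul_apply, map_sum, map_mul, Module.End.mul_apply]
    rw [Finset.sum_comm]

lemma evalHom_apply (B : Matrix (Fin l) (Fin l) (TwPoly φ)) (x : Fin l → H) (i : Fin l) :
    evalHom l φ B x i = ∑ j, TwPoly.eval (B i j) (x j) := by
  simp [evalHom, LinearMap.sum_apply, TwPoly.evalHom]

/-- The adjoint `B*`, the transpose of the matrix with entries `B_{ij}*`. -/
def star (B : Matrix (Fin l) (Fin l) (TwPoly φ)) : Matrix (Fin l) (Fin l) (TwPoly φ.symm) :=
  fun i j => TwPoly.star (B j i)

lemma star_mul (B C : Matrix (Fin l) (Fin l) (TwPoly φ)) : star (B * C) = star C * star B := by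
  ext1 i j
  have h (s : Finset (Fin l)) (F : Fin l → TwPoly φ) :
      TwPoly.star (∑ a ∈ s, F a) = ∑ a ∈ s, TwPoly.star (F a) :=
    map_sum (AddMonoidHom.mk' TwPoly.star TwPoly.star_add) F s
  simp only [star, Matrix.mul_apply, h, TwPoly.star_mul]

/-- The adjoint of a homomorphism from a commutative ring. -/
def starHom {A : Type*} [CommRing A] (ρ : A →+* Matrix (Fin l) (Fin l) (TwPoly φ)) :
    A →+* Matrix (Fin l) (Fin l) (TwPoly φ.symm) where
  toFun a := star (ρ a)
  map_one' := by
    ext1 i j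
    simp only [map_one, star, Matrix.one_apply, eq_comm (a := i)]
    split_ifs
    · exact TwPoly.star_one
    · exact TwPoly.star_zero
  map_zero' := by ext1 i j; simp [star, TwPoly.star_zero]
  map_add' a b := by ext1 i j; simp [star, TwPoly.star_add]
  map_mul' a b := by rw [mul_comm, map_mul, star_mul]

/-- `N` is the sum of the degrees of the diagonal entries of a diagonal matrix `U η V` with
invertible `U` and `V`. -/
def IsDiagonalDegree (η : Matrix (Fin l) (Fin l) (TwPoly φ)) (N : ℕ) : Prop :=
  ∃ (U V : (Matrix (Fin l) (Fin l) (TwPoly φ))ˣ) (d : Fin l → TwPoly φ),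
    (U : Matrix (Fin l) (Fin l) (TwPoly φ)) * η * (V : Matrix (Fin l) (Fin l) (TwPoly φ)) =
      Matrix.diagonal d ∧ N = ∑ i, (d i).deg

/-- The kernel of `η` on `H ^ l` has full dimension: its dimension over `k` is the sum of the
degrees of the entries of a diagonalization of `η`. -/
def KerFullDim (η : Matrix (Fin l) (Fin l) (TwPoly φ)) : Prop :=
  ∃ N : ℕ, IsDiagonalDegree η N ∧ Module.rank k (LinearMap.ker (evalHom l φ η)) = N

/-- The kernel of `η*` on `H ^ l` has full dimension. -/
def KerStarFullDim (η : Matrix (Fin l) (Fin l) (TwPoly φ)) : Prop :=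
  ∃ N : ℕ, IsDiagonalDegree η N ∧ Module.rank k (LinearMap.ker (evalHom l φ.symm (star η))) = N

/-- Right multiplication by a square matrix on row vectors, linear over `H` acting from the
left. -/
def rightMul (B : Matrix (Fin l) (Fin l) (TwPoly φ)) :
    (Fin l → TwPoly φ) →ₗ[Tw φ] (Fin l → TwPoly φ) where
  toFun m := Matrix.vecMul m B
  map_add' m n := Matrix.add_vecMul B m n
  map_smul' c m := funext fun j => by
    simp [Matrix.vecMul, dotProduct, Finset.smul_sum, TwPoly.smul_mul]

/-- The left `H[t]`-module `Mat_{1 × l}(H[φ])`, on which `t` acts as right multiplication by `B`,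
is free of rank `r`. -/
def MotiveFree (B : Matrix (Fin l) (Fin l) (TwPoly φ)) (r : ℕ) : Prop :=
  Nonempty (Module.Basis (Fin r) (Tw φ)[X] (Module.AEval' (rightMul B)))

open SkewPolynomial in
/-- Existence and uniqueness of the quotient in the definition of the Poonen pairing: if
`η(x) = 0`, then `xᵀ η* = (1 - σ) g` for a unique row vector `g` over `H[σ]`. -/
theorem existsUnique_quotient (η : Matrix (Fin l) (Fin l) (TwPoly φ)) (x : Fin l → H)
    (hx : evalHom l φ η x = 0) :
    ∃! g : Fin l → TwPoly φ.symm,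
      Matrix.vecMul (fun i => C (Tw.of φ.symm (x i))) (star η) = fun i => (1 - X) * g i := by
  have h (i : Fin l) : TwPoly.delta
      (Matrix.vecMul (fun i => C (Tw.of φ.symm (x i))) (star η) i) = 0 := by
    have hs (s : Finset (Fin l)) (F : Fin l → TwPoly φ.symm) :
        TwPoly.delta (∑ a ∈ s, F a) = ∑ a ∈ s, TwPoly.delta (F a) :=
      map_sum (AddMonoidHom.mk' TwPoly.delta TwPoly.delta_add) F s
    have := congrFun hx i
    rw [Pi.zero_apply] at this
    rw [← this]
    simp only [Matrix.vecMul, dotProduct, hs, star, TwPoly.delta_C_mul_star, evalHom_apply]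
  choose g hg using fun i => TwPoly.exists_division
    (Matrix.vecMul (fun i => C (Tw.of φ.symm (x i))) (star η) i)
  refine ⟨g, funext fun i => ?_, fun g' hg' => funext fun i => ?_⟩
  · have := hg i
    rwa [h, map_zero, C_0, add_zero] at this
  · have h1 := congrFun hg' i
    have h2 := hg i
    rw [h, map_zero, C_0, add_zero] at h2
    rw [← sub_eq_zero]
    refine TwPoly.eq_zero_of_one_sub_X_mul _ ?_
    rw [mul_sub, sub_eq_zero]
    exact h1.symm.trans h2

/-- The pairing `⟨x, y⟩_η = g_x(y)`, where `g_x` is the row vector over `H[σ]` such that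
`xᵀ η* = (1 - σ) g_x`. -/
def poonen (η : Matrix (Fin l) (Fin l) (TwPoly φ)) (x : LinearMap.ker (evalHom l φ η))
    (y : LinearMap.ker (evalHom l φ.symm (star η))) : H :=
  ∑ i, TwPoly.eval ((existsUnique_quotient η x.1 x.2).choose i) (y.1 i)

/-- The space `H ^ l` as a module over a ring `A` that is mapped to `Mat_l(H[φ])`. -/
def Points {A : Type*} [CommRing A] (_ρ : A →+* Matrix (Fin l) (Fin l) (TwPoly φ)) : Type _ :=
  Fin l → H

namespace Points

variable {A : Type*} [CommRing A] (ρ : A →+* Matrix (Fin l) (Fin l) (TwPoly φ))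

instance : AddCommGroup (Points ρ) := inferInstanceAs (AddCommGroup (Fin l → H))

instance : Module A (Points ρ) := Module.compHom (Fin l → H) ((evalHom l φ).comp ρ)

variable {ρ} in
/-- The `a`-torsion of `H ^ l` is the kernel of the matrix that `a` is mapped to. -/
def torsionKer (a : A) (x : Submodule.torsionBy A (Points ρ) a) :
    LinearMap.ker (evalHom l φ (ρ a)) :=
  ⟨x.1, x.2⟩

variable {ρ} in
/-- The `a`-torsion of `H ^ l` with respect to the adjoint is the kernel of the adjoint matrix. -/
def torsionKerStar (a : A) (y : Submodule.torsionBy A (Points (starHom ρ)) a) :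
    LinearMap.ker (evalHom l φ.symm (star (ρ a))) :=
  ⟨y.1, y.2⟩

/-- The pairing `⟨x, y⟩_η` for `η = ρ a`. -/
def pairing (a : A) (x : Submodule.torsionBy A (Points ρ) a)
    (y : Submodule.torsionBy A (Points (starHom ρ)) a) : H :=
  poonen (ρ a) (torsionKer a x) (torsionKerStar a y)

/-- A `k`-automorphism of `H` that commutes with `φ` and fixes the coefficients of all matrices in
the image of `A` acts on `H ^ l` coordinatewise. -/
def galois (Γ : H →ₐ[k] H) (hφ : ∀ x, Γ (φ x) = φ (Γ x))
    (hρ : ∀ a i j n, Γ (Tw.val ((ρ a i j).coeff n)) = Tw.val ((ρ a i j).coeff n)) :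
    Points ρ →ₗ[A] Points ρ where
  toFun x := fun i => Γ (x i)
  map_add' x y := funext fun i => map_add Γ _ _
  map_smul' a x := funext fun i => by
    change Γ (evalHom l φ (ρ a) x i) = evalHom l φ (ρ a) (fun i => Γ (x i)) i
    refine ((congrArg Γ (evalHom_apply _ _ _)).trans (map_sum Γ _ _)).trans
      (Eq.trans ?_ (evalHom_apply _ _ _).symm)
    exact Finset.sum_congr rfl fun j _ => TwPoly.map_eval Γ hφ _ (hρ a i j) _

end Points
end TwMat
end Twisted

/-! ### The fields `F(Z)` and `F((Z))` -/

/-- The possible meanings of the field attached to a field `F` and variables `z₁, …, zₙ`: rational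
functions, the fraction field of the power series ring, or iterated Laurent series (for `n ≤ 1`
the latter two are the same, namely formal Laurent series). -/
inductive ScalarKind
  | rational
  | laurent
  | iteratedLaurent

/-- The field `F(Z)` or `F((Z))` for `Z = {z₁, …, zₙ}`, according to the kind. A Hahn series over
`ℤⁿ` with the lexicographic order is the same as an iterated Laurent series in `n` variables. -/
def FZ (κ : ScalarKind) (n : ℕ) (F : Type*) [Field F] : Type _ :=
  match κ with
  | .rational => FractionRing (MvPolynomial (Fin n) F)
  | .laurent => FractionRing (MvPowerSeries (Fin n) F)
  | .iteratedLaurent => HahnSeries (Lex (Fin n → ℤ)) F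

namespace FZ

variable (κ : ScalarKind) (n : ℕ)

instance (F : Type*) [Field F] : Field (FZ κ n F) :=
  match κ with
  | .rational => inferInstanceAs (Field (FractionRing (MvPolynomial (Fin n) F)))
  | .laurent => inferInstanceAs (Field (FractionRing (MvPowerSeries (Fin n) F)))
  | .iteratedLaurent => inferInstanceAs (Field (HahnSeries (Lex (Fin n → ℤ)) F))

/-- The constants. -/
def const (F : Type*) [Field F] : F →+* FZ κ n F :=
  match κ with
  | .rational => (algebraMap (MvPolynomial (Fin n) F) (FractionRing _)).comp MvPolynomial.C
  | .laurent => (algebraMap (MvPowerSeries (Fin n) F) (FractionRing _)).comp MvPowerSeries.C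
  | .iteratedLaurent => HahnSeries.C

variable {F F' F'' : Type*} [Field F] [Field F'] [Field F'']

instance : IsDomain (MvPowerSeries (Fin n) F) := NoZeroDivisors.to_isDomain _

lemma mvPowerSeries_map_injective (g : F →+* F') :
    Function.Injective (MvPowerSeries.map (σ := Fin n) g) := fun a b h => by
  ext m
  exact g.injective (by simpa using congrArg (MvPowerSeries.coeff m) h)

/-- A homomorphism applied to the coefficients of Hahn series. -/
def hahnMap (g : F →+* F') :
    HahnSeries (Lex (Fin n → ℤ)) F →+* HahnSeries (Lex (Fin n → ℤ)) F' where
  toFun x := x.map g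
  map_one' := by
    ext a
    simp [HahnSeries.coeff_one, apply_ite g]
  map_zero' := by ext a; simp
  map_add' x y := by ext a; simp
  map_mul' x y := by
    have hs (x : HahnSeries (Lex (Fin n → ℤ)) F) : (x.map g).support = x.support := by
      ext a; simp
    ext a
    simp only [HahnSeries.map_coeff, HahnSeries.coeff_mul, map_sum, map_mul]
    refine Finset.sum_congr ?_ fun _ _ => rfl
    ext p
    simp only [Finset.mem_antidiagonal, hs]

lemma frac_map_map {R S T : Type*} [CommRing R] [IsDomain R] [CommRing S] [IsDomain S] [CommRing T]
    [IsDomain T] {g : R →+* S} {g' : S →+* T} {g'' : R →+* T} (hg : Function.Injective g)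
    (hg' : Function.Injective g') (hg'' : Function.Injective g'') (h : ∀ a, g' (g a) = g'' a)
    (x : FractionRing R) :
    IsFractionRing.map (K := FractionRing S) (L := FractionRing T) hg'
      (IsFractionRing.map (K := FractionRing R) (L := FractionRing S) hg x) =
    IsFractionRing.map (K := FractionRing R) (L := FractionRing T) hg'' x := by
  rw [← RingHom.comp_apply]
  refine congrArg (fun u : FractionRing R →+* FractionRing T => u x) ?_
  refine IsLocalization.ringHom_ext (nonZeroDivisors R) (RingHom.ext fun a => ?_)
  simp [IsFractionRing.map, h]

lemma frac_map_id {R : Type*} [CommRing R] [IsDomain R] {g : R →+* R} (hg : Function.Injective g)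
    (h : ∀ a, g a = a) (x : FractionRing R) :
    IsFractionRing.map (K := FractionRing R) (L := FractionRing R) hg x = x := by
  suffices IsFractionRing.map hg = RingHom.id (FractionRing R) from
    congrArg (fun u : FractionRing R →+* FractionRing R => u x) this
  refine IsLocalization.ringHom_ext (nonZeroDivisors R) (RingHom.ext fun a => ?_)
  simp [IsFractionRing.map, h]

/-- A homomorphism of fields, applied to the coefficients. -/
def map (g : F →+* F') : FZ κ n F →+* FZ κ n F' :=
  match κ with
  | .rational => IsFractionRing.map (A := MvPolynomial (Fin n) F) (B := MvPolynomial (Fin n) F')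
      (K := FractionRing (MvPolynomial (Fin n) F)) (L := FractionRing (MvPolynomial (Fin n) F'))
      (MvPolynomial.map_injective g g.injective)
  | .laurent => IsFractionRing.map (A := MvPowerSeries (Fin n) F) (B := MvPowerSeries (Fin n) F')
      (K := FractionRing (MvPowerSeries (Fin n) F)) (L := FractionRing (MvPowerSeries (Fin n) F'))
      (mvPowerSeries_map_injective n g)
  | .iteratedLaurent => hahnMap n g

lemma map_map (g : F →+* F') (g' : F' →+* F'') (x : FZ κ n F) :
    map κ n g' (map κ n g x) = map κ n (g'.comp g) x :=
  match κ, x with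
  | .rational, x => frac_map_map (MvPolynomial.map_injective g g.injective)
      (MvPolynomial.map_injective g' g'.injective) (MvPolynomial.map_injective _ (RingHom.injective _))
      (fun a => MvPolynomial.map_map g g' a) x
  | .laurent, x => frac_map_map (mvPowerSeries_map_injective n g)
      (mvPowerSeries_map_injective n g') (mvPowerSeries_map_injective n (g'.comp g))
      (fun a => by ext m; simp) x
  | .iteratedLaurent, _ => HahnSeries.ext (funext fun _ => rfl)

lemma map_id (x : FZ κ n F) : map κ n (RingHom.id F) x = x :=
  match κ, x with
  | .rational, x => frac_map_id (MvPolynomial.map_injective _ (RingHom.injective _)) (fun a => MvPolynomial.map_id a) x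
  | .laurent, x => frac_map_id (mvPowerSeries_map_injective n (RingHom.id F)) (fun a => by ext m; simp) x
  | .iteratedLaurent, _ => HahnSeries.ext (funext fun _ => rfl)

/-- For an extension `L / F`, the field `L(Z)` or `L((Z))` is an extension of `F(Z)` or `F((Z))`. -/
instance (priority := low) [Algebra F F'] : Algebra (FZ κ n F) (FZ κ n F') :=
  (map κ n (algebraMap F F')).toAlgebra

/-- An `F`-homomorphism, applied to the coefficients. -/
def mapAlgHom [Algebra F F'] [Algebra F F''] (g : F' →ₐ[F] F'') :
    FZ κ n F' →ₐ[FZ κ n F] FZ κ n F'' where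
  __ := map κ n (g : F' →+* F'')
  commutes' x := by
    change map κ n (g : F' →+* F'') (map κ n (algebraMap F F') x) = map κ n (algebraMap F F'') x
    rw [map_map, g.comp_algebraMap]

/-- An `F`-automorphism, applied to the coefficients. -/
def mapAlgEquiv [Algebra F F'] (g : F' ≃ₐ[F] F') : FZ κ n F' ≃ₐ[FZ κ n F] FZ κ n F' :=
  have h (g g' : F' ≃ₐ[F] F') (hg : ∀ x, g (g' x) = x) (x : FZ κ n F') :
      mapAlgHom κ n (g : F' →ₐ[F] F') (mapAlgHom κ n (g' : F' →ₐ[F] F') x) = x :=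
    (map_map κ n _ _ x).trans (Eq.trans (congrArg (fun u => map κ n u x) (show (g : F' →+* F').comp (g' : F' →+* F') = RingHom.id F' from
        RingHom.ext hg)) (map_id κ n x))
  AlgEquiv.ofAlgHom (mapAlgHom κ n (g : F' →ₐ[F] F')) (mapAlgHom κ n (g.symm : F' →ₐ[F] F'))
    (AlgHom.ext (h g g.symm g.apply_symm_apply)) (AlgHom.ext (h g.symm g g.symm_apply_apply))

/-- The automorphism `τ`, for an algebraic extension `L` of the finite field with `q` elements: it
raises the coefficients in `L` to the power `q` and fixes the variables. -/
def tau (Fq : Type*) [Field Fq] [Fintype Fq] (L : Type*) [Field L] [Algebra Fq L]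
    [Algebra.IsAlgebraic Fq L] : FZ κ n L ≃ₐ[FZ κ n Fq] FZ κ n L :=
  mapAlgEquiv κ n (FiniteField.frobeniusAlgEquivOfAlgebraic Fq L)

lemma mapAlgHom_tau (Fq : Type*) [Field Fq] [Fintype Fq] {L L' : Type*} [Field L] [Algebra Fq L]
    [Algebra.IsAlgebraic Fq L] [Field L'] [Algebra Fq L'] [Algebra.IsAlgebraic Fq L']
    (g : L →ₐ[Fq] L') (x : FZ κ n L) :
    mapAlgHom κ n g (tau κ n Fq L x) = tau κ n Fq L' (mapAlgHom κ n g x) :=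
  (map_map κ n _ _ x).trans (Eq.trans (congrArg (fun u => map κ n u x) (RingHom.ext fun a => by
    simp [FiniteField.coe_frobeniusAlgEquivOfAlgebraic])) (map_map κ n _ _ x).symm)

end FZ

/-! ### Anderson `t`-modules and their Tate modules -/

section Anderson

variable {Fq : Type*} [Field Fq] [Fintype Fq]

instance (f : Fq[X]) [Fact (Irreducible f)] : Algebra.IsAlgebraic Fq (AdjoinRoot f) :=
  have := (AdjoinRoot.powerBasis (Fact.out : Irreducible f).ne_zero).finite
  Algebra.IsAlgebraic.of_finite Fq (AdjoinRoot f)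

variable {F : Type*} [Field F] [Algebra Fq F] [Algebra.IsAlgebraic Fq F]

instance : Algebra.IsAlgebraic Fq (AlgebraicClosure F) := Algebra.IsAlgebraic.trans Fq F _

variable (Fq) in
/-- An Anderson `t`-module of dimension `l` over `F(Z)` or `F((Z))`, for an algebraic extension `F`
of the finite field `Fq` and `θbar ∈ F`: a homomorphism of algebras over `k = Fq(Z)` or `Fq((Z))`
from `k[t]` to the matrices of twisted polynomials, such that the constant term of the image of `t`
differs from the scalar matrix `θbar` by a nilpotent matrix. -/
structure AndersonModule (κ : ScalarKind) (n : ℕ) {F : Type*} [Field F] [Algebra Fq F]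
    [Algebra.IsAlgebraic Fq F] (θbar : F) (l : ℕ) where
  toAlgHom : (FZ κ n Fq)[X] →ₐ[FZ κ n Fq] Matrix (Fin l) (Fin l) (TwPoly (FZ.tau κ n Fq F))
  isNilpotent : IsNilpotent
    (Matrix.of (fun i j => Tw.val ((toAlgHom Polynomial.X i j).coeff 0)) -
      Matrix.scalar (Fin l) (FZ.const κ n F θbar))

namespace AndersonModule

variable {κ : ScalarKind} {n : ℕ} {θbar : F} {l : ℕ} (E : AndersonModule Fq κ n θbar l)

/-- The `t`-module over the extension `H = Fbar(Z)` or `Fbar((Z))`, where `Fbar` is the algebraic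
closure of `F`. -/
def baseChange : (FZ κ n Fq)[X] →+*
    Matrix (Fin l) (Fin l) (TwPoly (FZ.tau κ n Fq (AlgebraicClosure F))) :=
  (RingHom.mapMatrix (TwPoly.map (FZ.mapAlgHom κ n (IsScalarTower.toAlgHom Fq F _))
    (FZ.mapAlgHom_tau κ n Fq _))).comp E.toAlgHom.toRingHom

/-- The adjoint `t`-module over `H`. -/
abbrev adjoint : (FZ κ n Fq)[X] →+*
    Matrix (Fin l) (Fin l) (TwPoly (FZ.tau κ n Fq (AlgebraicClosure F)).symm) :=
  TwMat.starHom E.baseChange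

/-- The `k[t]`-module `E(H)`. -/
abbrev Points : Type _ := TwMat.Points E.baseChange

/-- The `k[t]`-module `E*(H)`. -/
abbrev AdjointPoints : Type _ := TwMat.Points E.adjoint

/-- The Poonen pairing `⟨x, y⟩` with respect to `η = E_ν`. -/
def poonenPairing (ν : (FZ κ n Fq)[X]) (x : Submodule.torsionBy _ E.Points ν)
    (y : Submodule.torsionBy _ E.AdjointPoints ν) : FZ κ n (AlgebraicClosure F) :=
  TwMat.Points.pairing E.baseChange ν x y

/-- The pairing `[x, y]_ν`, which takes `x ∈ E[ν]` and `y ∈ E*[ν]` to the function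
`a ↦ ⟨E_a(x), y⟩` on `k[t]`. -/
def bracket (ν : (FZ κ n Fq)[X]) (x : Submodule.torsionBy _ E.Points ν)
    (y : Submodule.torsionBy _ E.AdjointPoints ν) (a : (FZ κ n Fq)[X]) :
    FZ κ n (AlgebraicClosure F) :=
  E.poonenPairing ν (a • x) y

/-- The action of the Galois group of `Fbar / F` on `H`. -/
def galoisH (κ : ScalarKind) (n : ℕ) (γ : AlgebraicClosure F ≃ₐ[F] AlgebraicClosure F) :
    FZ κ n (AlgebraicClosure F) →ₐ[FZ κ n Fq] FZ κ n (AlgebraicClosure F) :=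
  FZ.mapAlgHom κ n ((γ : AlgebraicClosure F →ₐ[F] AlgebraicClosure F).restrictScalars Fq)

lemma galoisH_tau (γ : AlgebraicClosure F ≃ₐ[F] AlgebraicClosure F)
    (x : FZ κ n (AlgebraicClosure F)) :
    galoisH (Fq := Fq) κ n γ (FZ.tau κ n Fq _ x) = FZ.tau κ n Fq _ (galoisH (Fq := Fq) κ n γ x) :=
  FZ.mapAlgHom_tau κ n Fq _ x

lemma galoisH_tau_symm (γ : AlgebraicClosure F ≃ₐ[F] AlgebraicClosure F)
    (x : FZ κ n (AlgebraicClosure F)) :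
    galoisH (Fq := Fq) κ n γ ((FZ.tau κ n Fq _).symm x) =
      (FZ.tau κ n Fq _).symm (galoisH (Fq := Fq) κ n γ x) := by
  rw [AlgEquiv.eq_symm_apply, ← galoisH_tau, AlgEquiv.apply_symm_apply]

lemma galoisH_baseChange (γ : AlgebraicClosure F ≃ₐ[F] AlgebraicClosure F) (a : (FZ κ n Fq)[X])
    (i j : Fin l) (m : ℕ) : galoisH (Fq := Fq) κ n γ (Tw.val ((E.baseChange a i j).coeff m)) =
      Tw.val ((E.baseChange a i j).coeff m) := by
  have h : (E.baseChange a i j).coeff m = Tw.of _ (FZ.mapAlgHom κ n (IsScalarTower.toAlgHom Fq F _)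
      (Tw.val ((E.toAlgHom a i j).coeff m))) := TwPoly.coeff_map _ (FZ.mapAlgHom_tau κ n Fq _) _ _
  rw [h]
  refine (FZ.map_map κ n _ _ _).trans (congrArg (fun u => FZ.map κ n u _) (RingHom.ext fun b => ?_))
  exact γ.commutes b

lemma galoisH_adjoint (γ : AlgebraicClosure F ≃ₐ[F] AlgebraicClosure F) (a : (FZ κ n Fq)[X])
    (i j : Fin l) (m : ℕ) : galoisH (Fq := Fq) κ n γ (Tw.val ((E.adjoint a i j).coeff m)) =
      Tw.val ((E.adjoint a i j).coeff m) := by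
  have h : (E.adjoint a i j).coeff m = Tw.of _ (((FZ.tau κ n Fq (AlgebraicClosure F)).symm ^ m :
      FZ κ n (AlgebraicClosure F) ≃ₐ[FZ κ n Fq] FZ κ n (AlgebraicClosure F))
      (Tw.val ((E.baseChange a j i).coeff m))) := TwPoly.coeff_star _ _
  have hp (x : FZ κ n (AlgebraicClosure F)) : galoisH (Fq := Fq) κ n γ
      (((FZ.tau κ n Fq (AlgebraicClosure F)).symm ^ m :
        FZ κ n (AlgebraicClosure F) ≃ₐ[FZ κ n Fq] FZ κ n (AlgebraicClosure F)) x) =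
      ((FZ.tau κ n Fq (AlgebraicClosure F)).symm ^ m :
        FZ κ n (AlgebraicClosure F) ≃ₐ[FZ κ n Fq] FZ κ n (AlgebraicClosure F))
        (galoisH (Fq := Fq) κ n γ x) := by
    clear h
    induction m generalizing x with
    | zero => rfl
    | succ m ih =>
      rw [pow_succ', AlgEquiv.mul_apply, AlgEquiv.mul_apply, galoisH_tau_symm, ih]
  rw [h, Tw.val_of, hp, galoisH_baseChange]

/-- The `l`-adic Tate module of `E`, the inverse limit of the modules `E[l ^ m]`. -/
abbrev tate (lam : (FZ κ n Fq)[X]) : Type _ := TateModule lam E.Points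

/-- The `l`-adic Tate module of `E*`. -/
abbrev adjointTate (lam : (FZ κ n Fq)[X]) : Type _ := TateModule lam E.AdjointPoints

/-- The Galois action on the Tate module of `E`. -/
def tateGalois (lam : (FZ κ n Fq)[X]) (γ : AlgebraicClosure F ≃ₐ[F] AlgebraicClosure F) :
    E.tate lam → E.tate lam :=
  TateModule.map (TwMat.Points.galois E.baseChange (galoisH κ n γ) (galoisH_tau γ)
    (E.galoisH_baseChange γ))

/-- The Galois action on the Tate module of `E*`. -/
def adjointTateGalois (lam : (FZ κ n Fq)[X]) (γ : AlgebraicClosure F ≃ₐ[F] AlgebraicClosure F) :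
    E.adjointTate lam → E.adjointTate lam :=
  TateModule.map (TwMat.Points.galois E.adjoint (galoisH κ n γ) (galoisH_tau_symm γ)
    (E.galoisH_adjoint γ))

/-- The `t`-motive and the dual `t`-motive of `E` over `H` are free over `H[t]` of the same rank,
and `E[lam ^ m]` and `E*[lam ^ m]` have full dimension for all `m ≥ 1`. -/
def TateConditions (lam : (FZ κ n Fq)[X]) : Prop :=
  (∃ r : ℕ, TwMat.MotiveFree (E.baseChange Polynomial.X) r ∧
    TwMat.MotiveFree (E.adjoint Polynomial.X) r) ∧
  ∀ m : ℕ, 1 ≤ m → TwMat.KerFullDim (E.baseChange (lam ^ m)) ∧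
    TwMat.KerStarFullDim (E.baseChange (lam ^ m))

end AndersonModule
end Anderson
end

noncomputable section

/-! ### Pairings of Tate modules -/

namespace TateModule

section Lim

variable {A : Type*} [CommRing A] {l : A} {M N P : Type*} [AddCommGroup M] [Module A M]
  [AddCommGroup N] [Module A N] [AddCommGroup P] [Module A P]

/-! The ring $k[t]/(p)$ is a Frobenius algebra: for monic $p$ the functional
$a\mapsto\mathrm{res}_\infty(a/p)$ generates its dual freely. The functionals for $p=\lambda^m$ are
compatible under multiplication by $\lambda$, so together they are a free generator of $W_\lambda$
(`PolyDual.nonempty_tateModule_equiv`).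

The Poonen pairing for $\eta$ takes values in $H^\tau$, since $(1-\sigma)g_x(y)=x^{\mathsf
T}\eta^*(y)=0$, and $H^\tau=k$ (`FZ.fixedFieldEq_tau`). Everything formal follows from one identity:
if $\eta=ADB$, then $\langle x,y\rangle_\eta=\langle Bx,A^*y\rangle_D$ (`TwMat.poonen_eq_poonen`).
Factoring $\eta c=c\eta$ in two ways gives linearity over $k$, factoring $\mathcal E_{\nu b}$ in two
ways gives $\langle bx,y\rangle=\langle x,by\rangle$, factoring $\mathcal E_{\lambda^{m+1}}$ gives
compatibility of the levels $m$, and a diagonalization of $\eta$ reduces nondegeneracy to single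
twisted polynomials.

For one twisted polynomial $d\ne0$ and $x\neq 0$, the quotient $g$ of $xd^*$ by $1-\sigma$ is
nonzero of degree less than $\deg d$. A nonzero twisted polynomial of degree $s$ has a kernel of
dimension at most $s$ over $k$ (`rank_ker_twistedOperator_le`), so $g$ cannot vanish on $\ker d^*$
when the latter has dimension $\deg d$. With equal finite dimensions on both sides this makes each
level perfect (`TwMat.isPerfPair_poonenForm`).

Perfectness passes to the limit (`TateModule.bijective_pairing`). At finite level, multiplication by
$\lambda$ is adjoint to an injective inclusion, hence surjective; so the Tate modules project onto
the torsion modules, and an $\mathcal A_\lambda$-linear functional on a Tate module descends to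
linear forms on all levels, each of which is represented. -/

lemma pow_smul_apply (x : TateModule l M) (i m : ℕ) : l ^ i • x.1 (m + i) = x.1 m := by
  induction i with
  | zero => simp
  | succ i ih => rw [pow_succ, mul_smul, ← add_assoc, x.2.2, ih]

/-- The shift of a compatible system that vanishes at `m`, which divides it by `l ^ m`. -/
def shift (x : TateModule l M) (m : ℕ) (hx : x.1 m = 0) : TateModule l M :=
  ⟨fun i => x.1 (i + m), fun i => by
    change l ^ i • x.1 (i + m) = 0
    rw [add_comm i m, pow_smul_apply x i m, hx], fun i => by
    change l • x.1 (i + 1 + m) = x.1 (i + m)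
    rw [add_right_comm]; exact x.2.2 _⟩

lemma algebraMap_smul_apply (a : A) (x : TateModule l M) (m : ℕ) :
    ((algebraMap A (AdicRing l) a) • x).1 m = a • x.1 m := by
  change rep _ m • x.1 m = _
  refine smul_eq_of_mk_eq (x.2.1 m) ?_
  rw [mk_rep]
  exact AdicCompletion.evalₐ_of _ _ _

lemma algebraMap_pow_smul_shift (x : TateModule l M) (m : ℕ) (hx : x.1 m = 0) :
    algebraMap A (AdicRing l) (l ^ m) • shift x m hx = x :=
  Subtype.ext <| funext fun i => by
    rw [algebraMap_smul_apply]
    exact pow_smul_apply x m i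

/-- A system that vanishes at level $m$ is $l^m$ times its shift, and a linear map carries $l^m$
along. Linear maps to $A_l$ are therefore automatically continuous. -/
lemma evalₐ_eq_zero_of_apply_eq_zero (Θ : TateModule l M →ₗ[AdicRing l] AdicRing l)
    (x : TateModule l M) (m : ℕ) (hx : x.1 m = 0) :
    AdicCompletion.evalₐ (Ideal.span {l}) m (Θ x) = 0 := by
  rw [← algebraMap_pow_smul_shift x m hx, map_smul, smul_eq_mul, map_mul]
  have : AdicCompletion.evalₐ (Ideal.span {l}) m (algebraMap A (AdicRing l) (l ^ m)) = 0 := by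
    refine (AdicCompletion.evalₐ_of _ _ _).trans ?_
    rw [Ideal.Quotient.eq_zero_iff_mem]
    exact Ideal.pow_mem_pow (Ideal.mem_span_singleton_self l) m
  rw [this, zero_mul]

/-- Level by level, $w_m$ is a free generator of $M[l^m]$ over $A/l^m$; the scalars that express a
given system in terms of $w$ are then unique modulo $l^m$ and glue to an element of the completion.
-/
lemma bijective_toSpanSingleton (w : TateModule l M)
    (hinj : ∀ m r, r • w.1 m = 0 → l ^ m ∣ r)
    (hsurj : ∀ m (u : M), l ^ m • u = 0 → ∃ r : A, r • w.1 m = u) :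
    Function.Bijective (LinearMap.toSpanSingleton (AdicRing l) (TateModule l M) w) := by
  constructor
  · rw [injective_iff_map_eq_zero]
    intro a ha
    refine AdicCompletion.ext_evalₐ fun m => ?_
    rw [map_zero, ← mk_rep, Ideal.Quotient.eq_zero_iff_mem, Ideal.span_singleton_pow,
      Ideal.mem_span_singleton]
    exact hinj m _ (congrFun (congrArg Subtype.val ha) m)
  · intro u
    choose r hr using fun m => hsurj m (u.1 m) (u.2.1 m)
    -- Both $r_m$ and $r_{m+1}$ take $w_m=l\,w_{m+1}$ to $u_m=l\,u_{m+1}$, so their difference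
    -- annihilates $w_m$.
    have hc (m : ℕ) : r m ≡ r (m + 1) [SMOD (Ideal.span {l} ^ m • ⊤ : Ideal A)] := by
      rw [SModEq.sub_mem, smul_eq_mul, Ideal.mul_top, Ideal.span_singleton_pow,
        Ideal.mem_span_singleton]
      refine hinj m _ ?_
      rw [sub_smul, hr, ← w.2.2 m, smul_comm, hr, u.2.2, sub_self]
    refine ⟨AdicCompletion.mk _ _ (AdicCompletion.AdicCauchySequence.mk _ _ r hc), ?_⟩
    refine Subtype.ext <| funext fun m => ?_
    change rep _ m • w.1 m = _
    rw [← hr m]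
    refine smul_eq_of_mk_eq (w.2.1 m) ?_
    rw [mk_rep]
    exact AdicCompletion.evalₐ_mk (I := Ideal.span {l}) _ _

lemma proj_surjective (h : ∀ m (x : M), l ^ m • x = 0 → ∃ x', l ^ (m + 1) • x' = 0 ∧ l • x' = x)
    (m : ℕ) : Function.Surjective (proj (l := l) (M := M) m) := by
  rintro ⟨x, hx⟩
  choose g hg hg' using h
  -- A chain of successive preimages of $x$, with $s_i\in M[l^{m+i}]$. The lift of $x$ has $i$-th
  -- component $l^m s_i$; this one formula serves the levels below and above $m$ alike, and gives
  -- $x$ at $i=m$.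
  let s : ∀ i, {z : M // l ^ (m + i) • z = 0} := fun i =>
    Nat.rec ⟨x, hx⟩ (fun i z => ⟨g (m + i) z.1 z.2, hg _ _ _⟩) i
  have hs (i : ℕ) : l • (s (i + 1)).1 = (s i).1 := hg' _ _ _
  have hs' (i : ℕ) : l ^ i • (s i).1 = x := by
    induction i with
    | zero => rw [pow_zero, one_smul]; rfl
    | succ i ih => rw [pow_succ, mul_smul, hs, ih]
  refine ⟨⟨fun i => l ^ m • (s i).1, fun i => ?_, fun i => ?_⟩, Subtype.ext (hs' m)⟩
  · rw [smul_smul, ← pow_add, add_comm, (s i).2]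
  · rw [smul_comm, hs]

variable (c : ∀ m, Submodule.torsionBy A M (l ^ m) →ₗ[A] Submodule.torsionBy A N (l ^ m) →ₗ[A] P)

/-- A family of bilinear maps `M[l ^ m] × N[l ^ m] → P` is compatible if the multiplication
`l : N[l ^ (m + 1)] → N[l ^ m]` is adjoint to the inclusion `M[l ^ m] ⊆ M[l ^ (m + 1)]`. -/
def AdjointInclusion : Prop :=
  ∀ m (x : M) (y : N) (hx : l ^ m • x = 0) (hx' : l ^ (m + 1) • x = 0) (hy : l ^ (m + 1) • y = 0)
    (hy' : l ^ m • l • y = 0), c (m + 1) ⟨x, hx'⟩ ⟨y, hy⟩ = c m ⟨x, hx⟩ ⟨l • y, hy'⟩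

variable {c}

/-- The pairing of Tate modules induced by a compatible family of bilinear maps. -/
def pairing (hc : AdjointInclusion c) :
    TateModule l M →ₗ[AdicRing l] TateModule l N →ₗ[AdicRing l] TateModule l P :=
  LinearMap.mk₂ (AdicRing l) (fun x y => ⟨fun m => c m (proj m x) (proj m y), fun m => by
      rw [← map_smul, show l ^ m • proj m y = 0 from Subtype.ext (y.2.1 m), map_zero], fun m => by
      -- The factor $l$ goes into the left argument, $l\,c_{m+1}(x_{m+1},y_{m+1})=c_{m+1}(l
      -- x_{m+1},y_{m+1})$, which then comes from level $m$, so that the adjunction yields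
      -- $c_m(x_m,y_m)$.
      rw [← LinearMap.smul_apply, ← map_smul]
      have hx : l ^ m • l • x.1 (m + 1) = 0 := by rw [x.2.2, x.2.1]
      have hy : l ^ m • l • y.1 (m + 1) = 0 := by rw [y.2.2, y.2.1]
      have h := hc m (l • x.1 (m + 1)) (y.1 (m + 1)) hx
        (by rw [smul_comm, x.2.1, smul_zero]) (y.2.1 _) hy
      have hx' : (⟨l • x.1 (m + 1), hx⟩ : Submodule.torsionBy A M (l ^ m)) = proj m x :=
        Subtype.ext (x.2.2 m)
      have hy' : (⟨l • y.1 (m + 1), hy⟩ : Submodule.torsionBy A N (l ^ m)) = proj m y :=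
        Subtype.ext (y.2.2 m)
      rw [hx', hy'] at h
      exact h⟩)
    (fun x x' y => Subtype.ext <| funext fun m => by
      change c m (proj m x + proj m x') _ = _
      rw [map_add]; rfl)
    (fun a x y => Subtype.ext <| funext fun m => by
      change c m (rep a m • proj m x) _ = _
      rw [map_smul]; rfl)
    (fun x y y' => Subtype.ext <| funext fun m => by
      change c m _ (proj m y + proj m y') = _
      rw [map_add]; rfl)
    (fun a x y => Subtype.ext <| funext fun m => by
      change c m _ (rep a m • proj m y) = _
      rw [map_smul]; rfl)

lemma pairing_apply (hc : AdjointInclusion c) (x : TateModule l M) (y : TateModule l N) (m : ℕ) :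
    (pairing hc x y).1 m = c m (proj m x) (proj m y) := rfl

lemma isOpen_setOf_apply_eq (x : TateModule l M) (m : ℕ) :
    IsOpen {x' : TateModule l M | x'.1 m = x.1 m} := by
  let _ : TopologicalSpace M := ⊥
  have : DiscreteTopology M := ⟨rfl⟩
  have : Continuous fun x' : TateModule l M => x'.1 m :=
    (continuous_apply m).comp continuous_induced_dom
  exact (isOpen_discrete {x.1 m}).preimage this

/-- Modulo $l^m$ the value depends only on the $m$-th components of the two arguments, so each
reduction is locally constant. No topology on the Tate module of $P$ is involved. -/
lemma continuous_pairing (hc : AdjointInclusion c)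
    (Θ : TateModule l P →ₗ[AdicRing l] AdicRing l) :
    Continuous fun p : TateModule l M × TateModule l N => Θ (pairing hc p.1 p.2) := by
  refine continuous_iInf_rng.2 fun m => continuous_induced_rng.2 ?_
  let _ : TopologicalSpace (A ⧸ Ideal.span {l} ^ m) := ⊥
  have : DiscreteTopology (A ⧸ Ideal.span {l} ^ m) := ⟨rfl⟩
  refine IsLocallyConstant.continuous ?_
  rw [IsLocallyConstant.iff_exists_open]
  rintro ⟨x, y⟩
  refine ⟨_, (isOpen_setOf_apply_eq x m).prod (isOpen_setOf_apply_eq y m), ⟨rfl, rfl⟩, ?_⟩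
  rintro ⟨x', y'⟩ ⟨hx, hy⟩
  change AdicCompletion.evalₐ _ m _ = AdicCompletion.evalₐ _ m _
  rw [← sub_eq_zero, ← map_sub, ← map_sub]
  refine evalₐ_eq_zero_of_apply_eq_zero Θ _ m ?_
  change c m (proj m x') (proj m y') - c m (proj m x) (proj m y) = 0
  rw [show proj m x' = proj m x from Subtype.ext hx, show proj m y' = proj m y from Subtype.ext hy,
    sub_self]

end Lim

/-! ### From perfect pairings of torsion modules to a perfect pairing of Tate modules -/

section Duality

lemma exists_comp_eq_of_ker_le {A M N P : Type*} [CommRing A] [AddCommGroup M] [Module A M]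
    [AddCommGroup N] [Module A N] [AddCommGroup P] [Module A P] {p : M →ₗ[A] N} {f : M →ₗ[A] P}
    (hp : Function.Surjective p) (h : LinearMap.ker p ≤ LinearMap.ker f) :
    ∃ g : N →ₗ[A] P, g ∘ₗ p = f := by
  refine ⟨(Submodule.liftQ _ f h) ∘ₗ (p.quotKerEquivOfSurjective hp).symm.toLinearMap,
    LinearMap.ext fun y => ?_⟩
  have : (p.quotKerEquivOfSurjective hp).symm (p y) = Submodule.Quotient.mk y := by
    rw [LinearEquiv.symm_apply_eq]; rfl
  rw [LinearMap.comp_apply, LinearMap.comp_apply, LinearEquiv.coe_coe, this]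
  rfl

/-- The dual of $k[t]$ is coinduced from $k$: a $k[t]$-linear map into it is the same as a
$k$-linear form, by evaluation at $1$. This is why perfectness is formulated below through values at
$1$. -/
lemma exists_forall_eq_apply_one {k N : Type*} [Field k] [AddCommGroup N] [Module k[X] N]
    [Module k N] [IsScalarTower k k[X] N] (V : N →ₗ[k[X]] PolyDual k) :
    ∃ f : N →ₗ[k] k, ∀ y, f y = V y 1 := by
  refine ⟨{ toFun := fun y => V y 1, map_add' := fun y y' => by rw [map_add]; rfl,
            map_smul' := fun a y => ?_ }, fun y => rfl⟩
  have h : a • y = (Polynomial.C a) • y := by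
    rw [← mul_one (Polynomial.C a), ← Polynomial.smul_eq_C_mul, smul_assoc, one_smul]
  rw [h, map_smul]
  change (show k[X] →ₗ[k] k from V y) (Polynomial.C a * 1) = _
  rw [← Polynomial.smul_eq_C_mul, map_smul]
  rfl

variable {k : Type*} [Field k] {l : k[X]} {M N : Type*} [AddCommGroup M] [Module k[X] M]
  [AddCommGroup N] [Module k[X] N] [Module k N] [IsScalarTower k k[X] N]
  {c : ∀ m, Submodule.torsionBy k[X] M (l ^ m) →ₗ[k[X]] Submodule.torsionBy k[X] N (l ^ m) →ₗ[k[X]]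
    PolyDual k}

/-- Under the pairings, multiplication by $l$ from $N[l^{m+1}]$ to $N[l^m]$ is the transpose of the
inclusion $M[l^m]\subseteq M[l^{m+1}]$, and the transpose of an injective map of vector spaces is
surjective. Concretely, a linear form that kills the image but not $y$ is represented by an $x$ that
pairs to zero with $N[l^{m+1}]$. -/
lemma exists_smul_eq_of_perfect (hc : AdjointInclusion c)
    (hinj : ∀ m x, (∀ y, c m x y 1 = 0) → x = 0)
    (hsurj : ∀ m (f : Submodule.torsionBy k[X] N (l ^ m) →ₗ[k] k), ∃ x, ∀ y, c m x y 1 = f y)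
    (m : ℕ) (y : N) (hy : l ^ m • y = 0) : ∃ y', l ^ (m + 1) • y' = 0 ∧ l • y' = y := by
  let L : Submodule.torsionBy k[X] N (l ^ (m + 1)) →ₗ[k[X]] Submodule.torsionBy k[X] N (l ^ m) :=
    LinearMap.codRestrict _ (l • Submodule.subtype _) fun z => by
      have := z.2
      rw [Submodule.mem_torsionBy_iff] at this ⊢
      rw [LinearMap.smul_apply, smul_smul, ← pow_succ]
      exact this
  by_contra hne
  have hy' : (⟨y, hy⟩ : Submodule.torsionBy k[X] N (l ^ m)) ∉
      LinearMap.range (L.restrictScalars k) := by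
    rintro ⟨z, hz⟩
    exact hne ⟨z.1, z.2, congrArg Subtype.val hz⟩
  obtain ⟨f, hf, hf'⟩ := Submodule.exists_dual_map_eq_bot_of_notMem hy' inferInstance
  obtain ⟨x, hx⟩ := hsurj m f
  have hxm : l ^ (m + 1) • x.1 = 0 := by
    rw [pow_succ', mul_smul, (Submodule.mem_torsionBy_iff _ _).1 x.2, smul_zero]
  have hx0 : (⟨x.1, hxm⟩ : Submodule.torsionBy k[X] M (l ^ (m + 1))) = 0 := by
    refine hinj _ _ fun z => ?_
    refine (congrArg (fun v : PolyDual k => v 1) (hc m x.1 z.1 x.2 hxm z.2 (L z).2)).trans ?_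
    refine (hx (L z)).trans ?_
    exact (Submodule.mem_bot k).1 (hf' ▸ Submodule.mem_map_of_mem ⟨z, rfl⟩)
  have h0 : x.1 = 0 := Subtype.ext_iff.1 hx0
  have : x = 0 := Subtype.ext h0
  rw [this] at hx
  exact hf (by rw [← hx ⟨y, hy⟩, map_zero]; rfl)

/-- For injectivity, each component is tested against $N[l^m]$, all of which lifts to the Tate
module. For surjectivity, a functional is transported through $\Theta^{-1}$ to systems of functions
on $k[t]$; its $m$-th component depends only on $y_m$ and is represented by some $x_m$, and
nondegeneracy forces the $x_m$ to be compatible. -/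
lemma bijective_pairing (hc : AdjointInclusion c) (hc' : AdjointInclusion fun m => (c m).flip)
    (hinj : ∀ m x, (∀ y, c m x y 1 = 0) → x = 0)
    (hsurj : ∀ m (f : Submodule.torsionBy k[X] N (l ^ m) →ₗ[k] k), ∃ x, ∀ y, c m x y 1 = f y)
    (Θ : TateModule l (PolyDual k) ≃ₗ[AdicRing l] AdicRing l) :
    Function.Bijective ((pairing hc).compr₂ Θ.toLinearMap) := by
  have hproj := proj_surjective (exists_smul_eq_of_perfect hc hinj hsurj)
  constructor
  · rw [injective_iff_map_eq_zero]
    intro x hx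
    refine Subtype.ext <| funext fun m => congrArg Subtype.val (hinj m (proj m x) fun y => ?_)
    obtain ⟨y, rfl⟩ := hproj m y
    have h : Θ (pairing hc x y) = 0 := congrArg (fun g => g y) hx
    rw [map_eq_zero_iff Θ Θ.injective] at h
    exact congrArg (fun u : TateModule l (PolyDual k) => u.1 m 1) h
  · intro g
    let u (y : TateModule l N) : TateModule l (PolyDual k) := Θ.symm (g y)
    -- If $y_m=0$, then $y$ is $l^m$ times a system, hence so is $u(y)$, whose $m$-th component is
    -- annihilated by $l^m$.
    have hu0 (m : ℕ) (y : TateModule l N) (hy : proj m y = 0) : (u y).1 m = 0 := by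
      have hy0 : y.1 m = 0 := congrArg Subtype.val hy
      rw [← algebraMap_pow_smul_shift y m hy0]
      simp only [u, map_smul]
      rw [algebraMap_smul_apply, (Θ.symm _).2.1 m]
    have hsplit (m : ℕ) : ∃ f : Submodule.torsionBy k[X] N (l ^ m) →ₗ[k] k,
        ∀ y, f (proj m y) = (u y).1 m 1 := by
      let U : TateModule l N →ₗ[k[X]] PolyDual k :=
        { toFun := fun y => (u y).1 m
          map_add' := fun y y' => by simp only [u, map_add]; rfl
          map_smul' := fun a y => by
            have h : a • y = algebraMap k[X] (AdicRing l) a • y :=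
              Subtype.ext <| funext fun i => (algebraMap_smul_apply a y i).symm
            simp only [u]
            rw [h, map_smul, map_smul, algebraMap_smul_apply]; rfl }
      have hker : LinearMap.ker (proj (l := l) (M := N) m) ≤ LinearMap.ker U := fun y hy => hu0 m y hy
      obtain ⟨V, hV⟩ := exists_comp_eq_of_ker_le (hproj m) hker
      obtain ⟨f, hf⟩ := exists_forall_eq_apply_one V
      exact ⟨f, fun y => (hf _).trans (congrArg (fun G => G y 1) hV)⟩
    choose f hf using hsplit
    choose x hx using fun m => hsurj m (f m)
    have key (m : ℕ) (y : TateModule l N) : c m (x m) (proj m y) 1 = (u y).1 m 1 :=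
      (hx m _).trans (hf m y)
    -- Paired with $y_m$, the element $l\,x_{m+1}$ gives the same as $x_{m+1}$ paired with $y_m$
    -- viewed in $N[l^{m+1}]$, by the flipped adjunction. There $y_m$ is the component of $l y$ at
    -- level $m+1$, so the value is $u(ly)_{m+1}=u(y)_m$ at $1$.
    have hl (m : ℕ) : l • (x (m + 1)).1 = (x m).1 := by
      have hm : l ^ m • l • (x (m + 1)).1 = 0 := by
        rw [smul_smul, ← pow_succ]; exact (x (m + 1)).2
      rw [← sub_eq_zero]
      refine congrArg Subtype.val (hinj m (⟨l • (x (m + 1)).1, hm⟩ - x m) fun z => ?_)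
      obtain ⟨y, rfl⟩ := hproj m z
      rw [map_sub, LinearMap.sub_apply]
      change c m _ _ 1 - c m _ _ 1 = 0
      rw [key, sub_eq_zero]
      have h2 := hc' m (y.1 m) (x (m + 1)).1 (y.2.1 m)
        (by rw [pow_succ', mul_smul, y.2.1, smul_zero]) (x (m + 1)).2 hm
      simp only [LinearMap.flip_apply] at h2
      change c m ⟨l • (x (m + 1)).1, hm⟩ ⟨y.1 m, y.2.1 m⟩ 1 = _
      rw [← h2]
      have h3 : (⟨y.1 m, by
          rw [Submodule.mem_torsionBy_iff, pow_succ', mul_smul, y.2.1, smul_zero]⟩ :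
          Submodule.torsionBy k[X] N (l ^ (m + 1))) =
          proj (m + 1) (algebraMap k[X] (AdicRing l) l • y) := Subtype.ext <| by
        change y.1 m = (algebraMap k[X] (AdicRing l) l • y).1 (m + 1)
        rw [algebraMap_smul_apply, y.2.2]
      have h4 : (u (algebraMap k[X] (AdicRing l) l • y)).1 (m + 1) = (u y).1 m := by
        simp only [u, map_smul]
        rw [algebraMap_smul_apply]
        exact (u y).2.2 m
      exact (congrArg (fun z => c (m + 1) (x (m + 1)) z 1) h3).trans
        ((key _ _).trans (congrArg (fun v : PolyDual k => v 1) h4))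
    let X : TateModule l M := ⟨fun m => (x m).1, fun m => (x m).2, hl⟩
    refine ⟨X, LinearMap.ext fun y => ?_⟩
    change Θ (pairing hc X y) = g y
    rw [← LinearEquiv.eq_symm_apply]
    refine Subtype.ext <| funext fun m => DFunLike.ext _ _ fun a => ?_
    -- Equality of the values at $1$ for $a y$ is equality of the values at $a$ for $y$.
    have h1 := key m (algebraMap k[X] (AdicRing l) a • y)
    have h2 : proj m (algebraMap k[X] (AdicRing l) a • y) = a • proj m y :=
      Subtype.ext (algebraMap_smul_apply a y m)
    have h3 : (u (algebraMap k[X] (AdicRing l) a • y)).1 m = a • (u y).1 m := by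
      simp only [u, map_smul]
      rw [algebraMap_smul_apply]
    rw [h2, map_smul, h3] at h1
    have h4 (v : PolyDual k) : (a • v) 1 = v a := congrArg (fun b => v b) (mul_one a)
    rw [h4, h4] at h1
    exact h1

/-- The pairing of Tate modules is perfect if the pairings of torsion modules are perfect as
pairings of vector spaces over `k`. -/
theorem isPerfPair_pairing [Module k M] [IsScalarTower k k[X] M] (hc : AdjointInclusion c)
    (hc' : AdjointInclusion fun m => (c m).flip)
    (h : ∀ m, (∀ x, (∀ y, c m x y 1 = 0) → x = 0) ∧
      ∀ f : Submodule.torsionBy k[X] N (l ^ m) →ₗ[k] k, ∃ x, ∀ y, c m x y 1 = f y)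
    (h' : ∀ m, (∀ y, (∀ x, c m x y 1 = 0) → y = 0) ∧
      ∀ f : Submodule.torsionBy k[X] M (l ^ m) →ₗ[k] k, ∃ y, ∀ x, c m x y 1 = f x)
    (Θ : TateModule l (PolyDual k) ≃ₗ[AdicRing l] AdicRing l) :
    ((pairing hc).compr₂ Θ.toLinearMap).IsPerfPair where
  bijective_left := bijective_pairing hc hc' (fun m => (h m).1) (fun m => (h m).2) Θ
  bijective_right := by
    have : ((pairing hc).compr₂ Θ.toLinearMap).flip = (pairing hc').compr₂ Θ.toLinearMap :=
      LinearMap.ext₂ fun _ _ => rfl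
    rw [this]
    exact bijective_pairing hc' hc (fun m => (h' m).1) (fun m => (h' m).2) Θ

end Duality

end TateModule

/-! ### The Tate module of the dual of `k[t]` -/

namespace PolyDual

open Polynomial

variable {k : Type*} [Field k]

/-- The function `a ↦ res (a / p)` on `k[t]`, for the residue at infinity and a monic `p`. -/
def residue (p : k[X]) : PolyDual k :=
  (show k[X] →ₗ[k] k from lcoeff k (p.natDegree - 1) ∘ₗ Polynomial.modByMonicHom p)

lemma residue_apply (p a : k[X]) : residue p a = (a %ₘ p).coeff (p.natDegree - 1) := rfl

lemma smul_apply (a b : k[X]) (u : PolyDual k) : (a • u) b = u (a * b) := rfl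

lemma smul_residue_self {p : k[X]} (hp : p.Monic) : p • residue p = 0 :=
  DFunLike.ext _ _ fun a => by
    rw [smul_apply, residue_apply, (modByMonic_eq_zero_iff_dvd hp).2 (dvd_mul_right p a)]
    rfl

/-- This is $\mathrm{res}(qa/(qp))=\mathrm{res}(a/p)$: the remainder of $qa$ modulo $qp$ is $q$
times that of $a$ modulo $p$, and its relevant coefficient is unchanged because $q$ is monic.
Positive degree of $p$ keeps the index $\deg p-1$ from being truncated. -/
lemma smul_residue_mul {p q : k[X]} (hp : p.Monic) (hq : q.Monic) (hp' : 0 < p.natDegree) :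
    q • residue (q * p) = residue p :=
  DFunLike.ext _ _ fun a => by
    rw [smul_apply, residue_apply, residue_apply]
    have h : (q * a) %ₘ (q * p) = q * (a %ₘ p) := by
      refine ((div_modByMonic_unique (a /ₘ p) (q * (a %ₘ p)) (hq.mul hp) ⟨?_, ?_⟩)).2
      · conv_rhs => rw [← modByMonic_add_div a p]
        ring
      · rw [degree_mul, degree_mul]
        refine WithBot.add_lt_add_left ?_ (degree_modByMonic_lt a hp)
        rw [Ne, degree_eq_bot]; exact hq.ne_zero
    rw [h, hq.natDegree_mul hp, Nat.add_sub_assoc hp',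
      coeff_mul_add_eq_of_natDegree_le le_rfl, coeff_natDegree, hq, one_mul]
    exact Nat.le_sub_one_of_lt (natDegree_modByMonic_lt a hp fun h => by simp [h] at hp')

/-- If the remainder of $a$ were nonzero, multiplication by a suitable power of $X$ would move its
leading coefficient to degree $\deg p-1$, where the residue reads it off. -/
lemma dvd_of_smul_residue_eq_zero {p a : k[X]} (hp : p.Monic) (h : a • residue p = 0) : p ∣ a := by
  rw [← modByMonic_eq_zero_iff_dvd hp]
  by_contra h0
  have hp' : p ≠ 1 := by
    rintro rfl
    exact h0 (modByMonic_one a)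
  have hlt := natDegree_modByMonic_lt a hp hp'
  set r := a %ₘ p with hr
  have h1 : (a * X ^ (p.natDegree - 1 - r.natDegree)) %ₘ p =
      r * X ^ (p.natDegree - 1 - r.natDegree) := by
    rw [← modByMonic_add_div a p, add_mul, mul_assoc, add_modByMonic,
      (modByMonic_eq_zero_iff_dvd hp).2 (dvd_mul_right p _), add_zero, modByMonic_eq_self_iff hp,
      ← hr]
    rw [degree_eq_natDegree hp.ne_zero, degree_eq_natDegree (mul_ne_zero h0 (by simp)),
      natDegree_mul_X_pow _ h0]
    exact_mod_cast (by omega)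
  have h2 : residue p (a * X ^ (p.natDegree - 1 - r.natDegree)) = 0 :=
    congrArg (fun u : PolyDual k => u (X ^ (p.natDegree - 1 - r.natDegree))) h
  rw [residue_apply, h1, show p.natDegree - 1 = r.natDegree + (p.natDegree - 1 - r.natDegree) by
    omega, show r.natDegree + (p.natDegree - 1 - r.natDegree) - r.natDegree =
      p.natDegree - 1 - r.natDegree by omega, coeff_mul_X_pow] at h2
  exact h0 (leadingCoeff_eq_zero.1 h2)

/-- The form $(a,b)\mapsto\mathrm{res}(ab/p)$ on polynomials of degree less than $\deg p$ is
nondegenerate by `dvd_of_smul_residue_eq_zero`. By finite dimension it represents every linear form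
there, and a functional killed by $p$ is determined by its restriction to these remainders. -/
lemma exists_smul_residue_eq {p : k[X]} (hp : p.Monic) (u : PolyDual k) (hu : p • u = 0) :
    ∃ a : k[X], a • residue p = u := by
  let n := p.natDegree
  let T : degreeLT k n →ₗ[k] Module.Dual k (degreeLT k n) :=
    LinearMap.mk₂ k (fun a b => residue p (a.1 * b.1))
      (fun a a' b => by
        rw [Submodule.coe_add, add_mul]; exact map_add (show k[X] →ₗ[k] k from residue p) _ _)
      (fun c a b => by
        rw [Submodule.coe_smul, smul_mul_assoc]
        exact map_smul (show k[X] →ₗ[k] k from residue p) _ _)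
      (fun a b b' => by
        rw [Submodule.coe_add, mul_add]; exact map_add (show k[X] →ₗ[k] k from residue p) _ _)
      (fun c a b => by
        rw [Submodule.coe_smul, mul_smul_comm]
        exact map_smul (show k[X] →ₗ[k] k from residue p) _ _)
  have hmod (a b : k[X]) : residue p (a * (b %ₘ p)) = residue p (a * b) := by
    rw [← sub_eq_zero]
    refine (map_sub (show k[X] →ₗ[k] k from residue p) _ _).symm.trans ?_
    rw [← mul_sub]
    have : b %ₘ p - b = p * -(b /ₘ p) := by
      conv_lhs => rw [modByMonic_eq_sub_mul_div]
      ring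
    rw [this, mul_left_comm]
    exact congrArg (fun v : PolyDual k => v (a * -(b /ₘ p))) (smul_residue_self hp)
  have hmem (b : k[X]) : b %ₘ p ∈ degreeLT k n := by
    rw [mem_degreeLT, ← degree_eq_natDegree hp.ne_zero]
    exact degree_modByMonic_lt b hp
  have hT : Function.Injective T := by
    rw [injective_iff_map_eq_zero]
    rintro ⟨a, ha⟩ h
    have h0 : p ∣ a := dvd_of_smul_residue_eq_zero hp <| DFunLike.ext _ _ fun b => by
      rw [smul_apply, ← hmod]
      exact congrArg (fun g => g ⟨b %ₘ p, hmem b⟩) h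
    refine Subtype.ext (eq_zero_of_dvd_of_degree_lt h0 ?_)
    rw [degree_eq_natDegree hp.ne_zero]
    exact mem_degreeLT.1 ha
  have : FiniteDimensional k (degreeLT k n) :=
    Module.Finite.equiv (degreeLTEquiv k n).symm
  obtain ⟨a, ha⟩ := (LinearMap.injective_iff_surjective_of_finrank_eq_finrank
    Subspace.dual_finrank_eq.symm).1 hT ((show k[X] →ₗ[k] k from u).domRestrict _)
  refine ⟨a.1, DFunLike.ext _ _ fun b => ?_⟩
  rw [smul_apply, ← hmod]
  refine (congrArg (fun g => g ⟨b %ₘ p, hmem b⟩) ha).trans ?_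
  change u (b %ₘ p) = u b
  conv_rhs => rw [← modByMonic_add_div b p]
  refine Eq.trans ?_ (map_add (show k[X] →ₗ[k] k from u) _ _).symm
  have : u (p * (b /ₘ p)) = 0 := congrArg (fun v : PolyDual k => v (b /ₘ p)) hu
  exact (add_eq_left.2 this).symm

/-- The compatible system of the residues `a ↦ res (a / p ^ m)`. -/
def residueSystem {p : k[X]} (hp : p.Monic) (hp' : 0 < p.natDegree) : TateModule p (PolyDual k) :=
  ⟨fun m => residue (p ^ m), fun m => smul_residue_self (hp.pow m), fun m => by
    cases m with
    -- At level $0$ the modulus is $1$, outside the range of `smul_residue_mul`; its residue is zero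
    -- because every remainder modulo $1$ is.
    | zero =>
      change p • residue (p ^ 1) = residue (p ^ 0)
      rw [pow_one, pow_zero, smul_residue_self hp]
      exact DFunLike.ext _ _ fun a => by rw [residue_apply, modByMonic_one]; rfl
    | succ m =>
      change p • residue (p ^ (m + 1 + 1)) = residue (p ^ (m + 1))
      rw [pow_succ' p (m + 1)]
      refine smul_residue_mul (hp.pow _) hp ?_
      rw [hp.natDegree_pow]; positivity⟩

theorem nonempty_tateModule_equiv {p : k[X]} (hp : p.Monic) (hp' : 0 < p.natDegree) :
    Nonempty (TateModule p (PolyDual k) ≃ₗ[AdicRing p] AdicRing p) :=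
  ⟨(LinearEquiv.ofBijective _ (TateModule.bijective_toSpanSingleton (residueSystem hp hp')
    (fun m _ h => dvd_of_smul_residue_eq_zero (hp.pow m) h)
    (fun m u h => exists_smul_residue_eq (hp.pow m) u h))).symm⟩

end PolyDual

universe u

/-! ### Kernels of twisted polynomials -/

section TwistedKernel

variable {k H : Type*} [Field k] [Field H] [Algebra k H] {φ : H ≃ₐ[k] H}

/-- Every element of `H` that is fixed by `φ` comes from `k`. -/
def FixedFieldEq (φ : H ≃ₐ[k] H) : Prop := ∀ x : H, φ x = x → x ∈ (algebraMap k H).range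

lemma FixedFieldEq.symm (h : FixedFieldEq φ) : FixedFieldEq φ.symm := fun x hx =>
  h x ((AlgEquiv.symm_apply_eq φ).1 hx).symm

/-- The `k`-linear operator `∑ i < n, aᵢ φ ^ i` on `H`. -/
def twistedOperator (φ : H ≃ₐ[k] H) (n : ℕ) (a : ℕ → H) : H →ₗ[k] H :=
  ∑ i ∈ Finset.range n, LinearMap.mulLeft k (a i) ∘ₗ (φ ^ i : H ≃ₐ[k] H).toLinearMap

lemma twistedOperator_apply (n : ℕ) (a : ℕ → H) (x : H) :
    twistedOperator φ n a x = ∑ i ∈ Finset.range n, a i * (φ ^ i : H ≃ₐ[k] H) x := by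
  simp [twistedOperator, LinearMap.sum_apply]

/-- Abel summation, whose boundary term is zero because the $a_i$ sum to $0$. For $v_i=\varphi^i(z)$
it splits off a right factor $\varphi-1$ from an operator that kills $1$. -/
lemma sum_mul_eq_sum_mul_sub (n : ℕ) (a v : ℕ → H) (h : ∑ i ∈ Finset.range (n + 1), a i = 0) :
    ∑ i ∈ Finset.range (n + 1), a i * v i =
      ∑ j ∈ Finset.range n, (-∑ i ∈ Finset.range (j + 1), a i) * (v (j + 1) - v j) := by
  have key (m : ℕ) : ∑ i ∈ Finset.range (m + 1), a i * v i =
      (∑ i ∈ Finset.range (m + 1), a i) * v m +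
      ∑ j ∈ Finset.range m, (-∑ i ∈ Finset.range (j + 1), a i) * (v (j + 1) - v j) := by
    induction m with
    | zero => simp
    | succ m ih =>
      rw [Finset.sum_range_succ, ih, Finset.sum_range_succ (fun j => _ * (v (j + 1) - v j)) m,
        Finset.sum_range_succ a (m + 1)]
      ring
  rw [key, h, zero_mul, zero_add]

lemma rank_le_rank_add_one {k : Type*} {V W : Type u} [Field k] [AddCommGroup V] [Module k V]
    [AddCommGroup W] [Module k W] (f : V →ₗ[k] W) (v : V)
    (h : ∀ w, f w = 0 → ∃ c : k, c • v = w) : Module.rank k V ≤ Module.rank k W + 1 := by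
  rw [← LinearMap.rank_range_add_rank_ker f]
  refine add_le_add (Submodule.rank_le _) ((rank_submodule_le_one_iff' _).2 ⟨v, fun w hw => ?_⟩)
  exact Submodule.mem_span_singleton.2 (h w hw)

/-- A nonzero twisted operator of order less than `n + 1` has a kernel of dimension at most `n`. -/
theorem rank_ker_twistedOperator_le (hφ : FixedFieldEq φ) (n : ℕ) (a : ℕ → H)
    (ha : ∃ i ≤ n, a i ≠ 0) : Module.rank k (LinearMap.ker (twistedOperator φ (n + 1) a)) ≤ n := by
  induction n generalizing a with
  | zero =>
    obtain ⟨i, hi, hai⟩ := ha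
    obtain rfl : i = 0 := by omega
    have : LinearMap.ker (twistedOperator φ (0 + 1) a) = ⊥ := by
      rw [LinearMap.ker_eq_bot']
      intro x hx
      rw [twistedOperator_apply] at hx
      simpa [hai] using hx
    rw [this]
    simp
  | succ n ih =>
    by_cases hW : LinearMap.ker (twistedOperator φ (n + 1 + 1) a) = ⊥
    · rw [hW]; simp
    obtain ⟨x, hx, hx0⟩ := Submodule.exists_mem_ne_zero_of_ne_bot hW
    -- Reduction of order: put $y=xz$ for a nonzero solution $x$. The operator in $z$ has
    -- coefficients $a_i\varphi^i(x)$ and kills $z=1$, so it factors through $z\mapsto\varphi(z)-z$.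
    let a' : ℕ → H := fun i => a i * (φ ^ i : H ≃ₐ[k] H) x
    have ha'0 (i : ℕ) : a' i = 0 ↔ a i = 0 := by
      simp only [a', mul_eq_zero, map_eq_zero_iff _ (AlgEquiv.injective _), hx0, or_false]
    have hsum : ∑ i ∈ Finset.range (n + 1 + 1), a' i = 0 := by
      rw [LinearMap.mem_ker, twistedOperator_apply] at hx
      exact hx
    let b : ℕ → H := fun j => -∑ i ∈ Finset.range (j + 1), a' i
    -- The $b_j$ are negated partial sums of the $a'_i$. If all were zero, so would be every $a'_i$;
    -- the last partial sum vanishes by `hsum`.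
    have hb : ∃ i ≤ n, b i ≠ 0 := by
      by_contra! hb
      have hs : ∀ j ≤ n + 1, ∑ i ∈ Finset.range (j + 1), a' i = 0 := by
        intro j hj
        rcases hj.lt_or_eq with hj | rfl
        · exact neg_eq_zero.1 (hb j (by omega))
        · exact hsum
      obtain ⟨i, hi, hai⟩ := ha
      refine hai ((ha'0 i).1 ?_)
      cases i with
      | zero => simpa using hs 0 hi
      | succ i => simpa [Finset.sum_range_succ _ (i + 1), hs i (by omega)] using hs (i + 1) hi
    let D : H →ₗ[k] H := (φ.toLinearMap - LinearMap.id) ∘ₗ LinearMap.mulLeft k x⁻¹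
    have hD (y : H) : D y = φ (x⁻¹ * y) - x⁻¹ * y := by simp [D]
    have hfac (y : H) : twistedOperator φ (n + 1 + 1) a y = twistedOperator φ (n + 1) b (D y) := by
      rw [twistedOperator_apply, twistedOperator_apply, hD]
      have h1 (i : ℕ) : a i * (φ ^ i : H ≃ₐ[k] H) y = a' i * (φ ^ i : H ≃ₐ[k] H) (x⁻¹ * y) := by
        simp only [a']
        rw [mul_assoc, ← map_mul, mul_inv_cancel_left₀ hx0]
      simp only [h1]
      rw [sum_mul_eq_sum_mul_sub _ _ _ hsum]
      refine Finset.sum_congr rfl fun j _ => ?_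
      rw [map_sub, pow_succ]
      rfl
    let D' : LinearMap.ker (twistedOperator φ (n + 1 + 1) a) →ₗ[k]
        LinearMap.ker (twistedOperator φ (n + 1) b) :=
      (D.domRestrict _).codRestrict _ fun y => by
        rw [LinearMap.mem_ker, LinearMap.domRestrict_apply, ← hfac]; exact y.2
    push_cast
    -- The kernel of $D$ is the line $kx$: there $x^{-1}y$ is fixed by $\varphi$.
    refine (rank_le_rank_add_one D' ⟨x, hx⟩ fun y hy => ?_).trans (add_le_add_left (ih b hb) 1)
    have hy : D y.1 = 0 := congrArg Subtype.val hy
    rw [hD, sub_eq_zero] at hy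
    obtain ⟨c, hc⟩ := hφ _ hy
    refine ⟨c, Subtype.ext ?_⟩
    change c • x = y.1
    rw [Algebra.smul_def, hc, mul_comm, mul_inv_cancel_left₀ hx0]

namespace TwPoly

lemma le_deg {p : TwPoly φ} {n : ℕ} (h : p.coeff n ≠ 0) : n ≤ p.deg :=
  Finset.le_sup (f := id) (SkewPolynomial.mem_support_iff.2 h)

lemma coeff_deg_ne_zero {p : TwPoly φ} (h : p ≠ 0) : p.coeff p.deg ≠ 0 := by
  have hne : p.support.Nonempty := by
    rw [Finset.nonempty_iff_ne_empty]
    intro h0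
    refine h (SkewPolynomial.ext fun n => ?_)
    by_contra hn
    have := SkewPolynomial.mem_support_iff.2 hn
    simp [h0] at this
  obtain ⟨i, hi, hi'⟩ := Finset.exists_mem_eq_sup _ hne id
  have : p.deg = i := hi'
  rw [this]
  exact SkewPolynomial.mem_support_iff.1 hi

lemma evalHom_eq_twistedOperator (p : TwPoly φ) :
    evalHom φ p = twistedOperator φ (p.deg + 1) fun i => Tw.val (p.coeff i) := by
  ext x
  rw [twistedOperator_apply]
  change eval p x = _
  rw [eval, SkewPolynomial.sum_def]
  refine Finset.sum_subset (fun i hi => ?_) fun i _ hi => ?_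
  · rw [Finset.mem_range, Nat.lt_succ_iff]
    exact le_deg (SkewPolynomial.mem_support_iff.1 hi)
  · rw [SkewPolynomial.mem_support_iff, not_not] at hi
    rw [hi, map_zero, zero_mul]

theorem rank_ker_evalHom_le (hφ : FixedFieldEq φ) {p : TwPoly φ} (hp : p ≠ 0) :
    Module.rank k (LinearMap.ker (evalHom φ p)) ≤ p.deg := by
  rw [evalHom_eq_twistedOperator]
  refine rank_ker_twistedOperator_le hφ _ _ ⟨p.deg, le_rfl, ?_⟩
  exact (map_ne_zero_iff _ (AlgEquiv.injective _)).2 (coeff_deg_ne_zero hp)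

lemma coeff_star_eq_zero_iff (p : TwPoly φ) (n : ℕ) : (star p).coeff n = 0 ↔ p.coeff n = 0 := by
  rw [coeff_star, map_eq_zero_iff _ (AlgEquiv.injective _),
    map_eq_zero_iff _ (AlgEquiv.injective _), map_eq_zero_iff _ (AlgEquiv.injective _)]

lemma deg_star (p : TwPoly φ) : (star p).deg = p.deg := by
  have : (star p).support = p.support := by
    ext n
    rw [SkewPolynomial.mem_support_iff, SkewPolynomial.mem_support_iff, Ne,
      coeff_star_eq_zero_iff]
  rw [deg, deg, this]

lemma star_eq_zero_iff (p : TwPoly φ) : star p = 0 ↔ p = 0 := by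
  constructor
  · intro h
    refine SkewPolynomial.ext fun n => ?_
    rw [SkewPolynomial.coeff_zero, ← coeff_star_eq_zero_iff, h, SkewPolynomial.coeff_zero]
  · rintro rfl; exact star_zero

open SkewPolynomial in
lemma coeff_C_mul' (a : Tw φ) (p : TwPoly φ) (n : ℕ) : (C a * p).coeff n = a * p.coeff n := by
  induction p using induct with
  | h1 m b =>
    rw [C_mul_monomial, coeff_monomial, coeff_monomial]
    split_ifs <;> simp
  | h2 p q hp hq => rw [mul_add, coeff_add', hp, hq, coeff_add', mul_add]

open SkewPolynomial in
-- The top coefficient of $Xg$ is the twist of that of $g$, hence nonzero, and in this degree $g$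
-- itself has no term to cancel it.
lemma deg_lt_deg_one_sub_X_mul {g : TwPoly φ} (hg : g ≠ 0) : g.deg < ((1 - X) * g).deg := by
  refine Nat.lt_of_succ_le (le_deg ?_)
  have h : (1 - X) * g + X * g = g := by rw [sub_mul, one_mul, sub_add_cancel]
  have h1 : ((1 - X) * g).coeff (g.deg + 1) + (X * g).coeff (g.deg + 1) = g.coeff (g.deg + 1) := by
    rw [← coeff_add', h]
  have h2 : g.coeff (g.deg + 1) = 0 := by
    by_contra h2
    exact absurd (le_deg h2) (by omega)
  intro h3
  rw [h3, h2, zero_add, coeff_X_mul_succ] at h1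
  exact coeff_deg_ne_zero hg (by
    simpa only [map_eq_zero_iff _ (AlgEquiv.injective _)] using h1)

open SkewPolynomial in
lemma eval_one_sub_X_mul (g : TwPoly φ) (y : H) : eval ((1 - X) * g) y = eval g y - φ (eval g y) := by
  have h : (1 - X) * g + X * g = g := by rw [sub_mul, one_mul, sub_add_cancel]
  have hX : eval (X * g) y = φ (eval g y) := by
    refine (congrArg (fun T : Module.End k H => T y) (map_mul (evalHom φ) X g)).trans ?_
    change eval X (eval g y) = _
    rw [← monomial_one_one_eq_X, eval_monomial, map_one, one_mul, pow_one]
  rw [eq_sub_iff_add_eq, ← hX, ← eval_add, h]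

end TwPoly

end TwistedKernel

/-! ### The Poonen pairing -/

namespace TwMat

open SkewPolynomial

variable {k H : Type*} [Field k] [Field H] [Algebra k H] {l : ℕ} {φ : H ≃ₐ[k] H}

/-- The value `∑ gᵢ(yᵢ)` of a row vector of twisted polynomials. -/
def rowEval (g : Fin l → TwPoly φ) : (Fin l → H) →ₗ[k] H :=
  ∑ i, TwPoly.evalHom φ (g i) ∘ₗ LinearMap.proj i

lemma rowEval_apply (g : Fin l → TwPoly φ) (y : Fin l → H) :
    rowEval g y = ∑ i, TwPoly.eval (g i) (y i) := by
  simp [rowEval, LinearMap.sum_apply, TwPoly.evalHom]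

lemma rowEval_add (g g' : Fin l → TwPoly φ) : rowEval (g + g') = rowEval g + rowEval g' := by
  simp [rowEval, LinearMap.add_comp, Finset.sum_add_distrib]

lemma rowEval_vecMul (g : Fin l → TwPoly φ) (B : Matrix (Fin l) (Fin l) (TwPoly φ))
    (y : Fin l → H) : rowEval (Matrix.vecMul g B) y = rowEval g (evalHom l φ B y) := by
  simp only [rowEval, LinearMap.sum_apply, LinearMap.comp_apply, LinearMap.proj_apply,
    Matrix.vecMul, dotProduct, map_sum, map_mul, Module.End.mul_apply, evalHom, RingHom.coe_mk,
    MonoidHom.coe_mk, OneHom.coe_mk, LinearMap.pi_apply]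
  exact Finset.sum_comm

lemma rowEval_one_sub_X_mul (g : Fin l → TwPoly φ) (y : Fin l → H) :
    rowEval (fun i => (1 - X) * g i) y = rowEval g y - φ (rowEval g y) := by
  simp only [rowEval_apply, TwPoly.eval_one_sub_X_mul, Finset.sum_sub_distrib, map_sum]

lemma one_sub_X_mul_vecMul (g : Fin l → TwPoly φ) (B : Matrix (Fin l) (Fin l) (TwPoly φ)) :
    Matrix.vecMul (fun i => (1 - X) * g i) B = fun i => (1 - X) * Matrix.vecMul g B i := by
  ext1 i
  simp only [Matrix.vecMul, dotProduct, Finset.mul_sum, mul_assoc]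

/-- The row vector of constants `xᵀ` over `H[σ]`. -/
def row (φ : H ≃ₐ[k] H) (x : Fin l → H) : Fin l → TwPoly φ.symm := fun i => C (Tw.of φ.symm (x i))

lemma row_add (x x' : Fin l → H) : row φ (x + x') = row φ x + row φ x' :=
  funext fun i => by simp [row]

/-- The remainder of $x^{\mathsf T}B^*$ on division by $1-\sigma$ from the left is the constant row
$B(x)^{\mathsf T}$. For $x\in\ker B$ this is the quotient behind the Poonen pairing; for general $x$
it is what lets the pairing be moved through a factor $B$. -/
lemma exists_vecMul_star (B : Matrix (Fin l) (Fin l) (TwPoly φ)) (x : Fin l → H) :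
    ∃ h : Fin l → TwPoly φ.symm, Matrix.vecMul (row φ x) (star B) =
      (fun i => (1 - X) * h i) + row φ (evalHom l φ B x) := by
  choose g hg using fun i => TwPoly.exists_division (Matrix.vecMul (row φ x) (star B) i)
  refine ⟨g, funext fun i => (hg i).trans ?_⟩
  have hs (s : Finset (Fin l)) (F : Fin l → TwPoly φ.symm) :
      TwPoly.delta (∑ a ∈ s, F a) = ∑ a ∈ s, TwPoly.delta (F a) :=
    map_sum (AddMonoidHom.mk' TwPoly.delta TwPoly.delta_add) F s
  have : TwPoly.delta (Matrix.vecMul (row φ x) (star B) i) = evalHom l φ B x i := by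
    simp only [Matrix.vecMul, dotProduct, hs, star, row, TwPoly.delta_C_mul_star, evalHom_apply]
  rw [this]
  rfl

/-- By uniqueness of the quotient, the pairing may be computed with any explicit $g$. -/
lemma poonen_eq {η : Matrix (Fin l) (Fin l) (TwPoly φ)} {x : LinearMap.ker (evalHom l φ η)}
    {y : LinearMap.ker (evalHom l φ.symm (star η))} {g : Fin l → TwPoly φ.symm}
    (hg : Matrix.vecMul (row φ x.1) (star η) = fun i => (1 - X) * g i) :
    poonen η x y = rowEval g y.1 := by
  rw [rowEval_apply]
  have h := (existsUnique_quotient η x.1 x.2).unique hg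
    (existsUnique_quotient η x.1 x.2).choose_spec.1
  rw [h]
  rfl

lemma exists_quotient (η : Matrix (Fin l) (Fin l) (TwPoly φ)) (x : LinearMap.ker (evalHom l φ η)) :
    ∃ g : Fin l → TwPoly φ.symm,
      Matrix.vecMul (row φ x.1) (star η) = fun i => (1 - X) * g i :=
  (existsUnique_quotient η x.1 x.2).exists

lemma poonen_add_left (η : Matrix (Fin l) (Fin l) (TwPoly φ))
    (x x' : LinearMap.ker (evalHom l φ η)) (y : LinearMap.ker (evalHom l φ.symm (star η))) :
    poonen η (x + x') y = poonen η x y + poonen η x' y := by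
  obtain ⟨g, hg⟩ := exists_quotient η x
  obtain ⟨g', hg'⟩ := exists_quotient η x'
  rw [poonen_eq hg, poonen_eq hg', poonen_eq (g := g + g'), rowEval_add, LinearMap.add_apply]
  rw [Submodule.coe_add, row_add, Matrix.add_vecMul, hg, hg']
  exact funext fun i => (mul_add _ _ _).symm

lemma poonen_add_right (η : Matrix (Fin l) (Fin l) (TwPoly φ))
    (x : LinearMap.ker (evalHom l φ η)) (y y' : LinearMap.ker (evalHom l φ.symm (star η))) :
    poonen η x (y + y') = poonen η x y + poonen η x y' := by
  obtain ⟨g, hg⟩ := exists_quotient η x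
  rw [poonen_eq hg, poonen_eq hg, poonen_eq hg, Submodule.coe_add, map_add]

lemma poonen_smul_right (η : Matrix (Fin l) (Fin l) (TwPoly φ))
    (c : k) (x : LinearMap.ker (evalHom l φ η)) (y : LinearMap.ker (evalHom l φ.symm (star η))) :
    poonen η x (c • y) = c • poonen η x y := by
  obtain ⟨g, hg⟩ := exists_quotient η x
  rw [poonen_eq hg, poonen_eq hg, Submodule.coe_smul, map_smul]

/-- The values of the Poonen pairing are fixed by `φ`. -/
lemma apply_poonen (η : Matrix (Fin l) (Fin l) (TwPoly φ))
    (x : LinearMap.ker (evalHom l φ η)) (y : LinearMap.ker (evalHom l φ.symm (star η))) :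
    φ (poonen η x y) = poonen η x y := by
  obtain ⟨g, hg⟩ := exists_quotient η x
  rw [poonen_eq hg]
  -- Evaluating $(1-\sigma)g=x^{\mathsf T}\eta^*$ at $y\in\ker\eta^*$ gives $g(y)=\sigma(g(y))$.
  have h := rowEval_one_sub_X_mul g y.1
  rw [← hg, rowEval_vecMul, LinearMap.mem_ker.1 y.2, map_zero, eq_comm, sub_eq_zero] at h
  conv_lhs => rw [h]
  exact φ.apply_symm_apply _

/-- If `η = A D B`, then `⟨x, y⟩_η = ⟨B(x), A*(y)⟩_D`. -/
theorem poonen_eq_poonen {η A D B : Matrix (Fin l) (Fin l) (TwPoly φ)} (h : η = A * D * B)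
    {x : LinearMap.ker (evalHom l φ η)} {y : LinearMap.ker (evalHom l φ.symm (star η))}
    {x' : LinearMap.ker (evalHom l φ D)} {y' : LinearMap.ker (evalHom l φ.symm (star D))}
    (hx : evalHom l φ B x.1 = x'.1) (hy : evalHom l φ.symm (star A) y.1 = y'.1) :
    poonen η x y = poonen D x' y' := by
  obtain ⟨u, hu⟩ := exists_vecMul_star B x.1
  obtain ⟨g, hg⟩ := exists_quotient D x'
  -- With $x^{\mathsf T}B^*=(1-\sigma)u+B(x)^{\mathsf T}$ and $B(x)^{\mathsf T}D^*=(1-\sigma)g$, the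
  -- quotient for $\eta^*=B^*D^*A^*$ is $uD^*A^*+gA^*$. Its first term vanishes at $y$, because
  -- $A^*(y)$ lies in $\ker D^*$.
  have hη : Matrix.vecMul (row φ x.1) (star η) =
      fun i => (1 - X) * (Matrix.vecMul (Matrix.vecMul u (star D)) (star A) +
        Matrix.vecMul g (star A)) i := by
    rw [show star η = _ from congrArg star h, star_mul, star_mul, ← Matrix.vecMul_vecMul, ← Matrix.vecMul_vecMul, hu, hx,
      Matrix.add_vecMul, Matrix.add_vecMul, hg, one_sub_X_mul_vecMul, one_sub_X_mul_vecMul,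
      one_sub_X_mul_vecMul]
    exact funext fun i => (mul_add _ _ _).symm
  rw [poonen_eq hη, poonen_eq hg, rowEval_add, LinearMap.add_apply, rowEval_vecMul, rowEval_vecMul,
    rowEval_vecMul, hy, LinearMap.mem_ker.1 y'.2, map_zero, zero_add]

end TwMat

/-! ### Linearity over $k$, and perfectness in full dimension -/

lemma LinearMap.ker_units_mul_mul_equiv {k W : Type*} [Field k] [AddCommGroup W] [Module k W]
    (U V : (Module.End k W)ˣ) (T : Module.End k W) :
    Nonempty (LinearMap.ker (U.1 * T * V.1) ≃ₗ[k] LinearMap.ker T) := by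
  have h1 (x : W) : V.1 (V⁻¹.1 x) = x := congrArg (fun S : Module.End k W => S x) V.mul_inv
  have h2 (x : W) : V⁻¹.1 (V.1 x) = x := congrArg (fun S : Module.End k W => S x) V.inv_mul
  have h3 (x : W) : U⁻¹.1 (U.1 x) = x := congrArg (fun S : Module.End k W => S x) U.inv_mul
  refine ⟨LinearEquiv.ofLinearMap (V.1.restrict (p := LinearMap.ker (U.1 * T * V.1))
    (q := LinearMap.ker T) fun x hx => ?_)
    (V⁻¹.1.restrict fun x hx => ?_) (LinearMap.ext fun x => Subtype.ext (h1 x))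
    (LinearMap.ext fun x => Subtype.ext (h2 x))⟩
  · rw [LinearMap.mem_ker] at hx ⊢
    rw [← h3 (T (V.1 x))]
    exact (congrArg _ hx).trans (map_zero _)
  · rw [LinearMap.mem_ker] at hx ⊢
    change U.1 (T (V.1 (V⁻¹.1 x))) = 0
    rw [h1, hx, map_zero]

namespace TwPoly

open SkewPolynomial

variable {k H : Type*} [Field k] [Field H] [Algebra k H] {φ : H ≃ₐ[k] H}

lemma algebraMap_eq_monomial (c : k) :
    algebraMap k (TwPoly φ) c = monomial 0 (Tw.of φ (algebraMap k H c)) := by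
  rfl

lemma eval_algebraMap (c : k) (x : H) : eval (algebraMap k (TwPoly φ) c) x = c • x := by
  rw [algebraMap_eq_monomial, eval_monomial, Algebra.smul_def]; rfl

lemma star_algebraMap (c : k) :
    star (algebraMap k (TwPoly φ) c) = algebraMap k (TwPoly φ.symm) c := by
  rw [algebraMap_eq_monomial, star_monomial]; rfl

/-- If `d*` has a kernel of full dimension, then the pairing of `d` is nondegenerate on the left. -/
lemma exists_eval_quotient_ne_zero (hφ : FixedFieldEq φ) {d : TwPoly φ} (hd : d ≠ 0)
    (hr : Module.finrank k (LinearMap.ker (evalHom φ.symm (star d))) = d.deg) {x : H}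
    (hx : x ≠ 0) {g : TwPoly φ.symm} (hg : C (Tw.of φ.symm x) * star d = (1 - X) * g) :
    ∃ y, eval (star d) y = 0 ∧ eval g y ≠ 0 := by
  by_contra! h
  have hx' : Tw.of φ.symm x ≠ 0 := (map_ne_zero_iff _ (AlgEquiv.injective _)).2 hx
  -- Neither the nonzero constant $x$ nor the adjoint changes the support, so $(1-\sigma)g$ has the
  -- degree of $d$ and $g$ a smaller one. If $g$ vanished on $\ker d^*$, its kernel would be larger
  -- than its degree allows.
  have hcoeff (n : ℕ) : ((1 - X) * g).coeff n = 0 ↔ d.coeff n = 0 := by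
    rw [← hg, coeff_C_mul', mul_eq_zero, or_iff_right hx', coeff_star_eq_zero_iff]
  have hg0 : g ≠ 0 := by
    rintro rfl
    refine coeff_deg_ne_zero hd ((hcoeff _).1 ?_)
    rw [mul_zero, coeff_zero]
  have hdeg : ((1 - X) * g).deg ≤ d.deg := by
    by_cases h0 : (1 - X) * g = 0
    · rw [h0]; simp [deg]
    · exact le_deg fun h1 => coeff_deg_ne_zero h0 ((hcoeff _).2 h1)
  have hlt := (deg_lt_deg_one_sub_X_mul hg0).trans_le hdeg
  have hle : LinearMap.ker (evalHom φ.symm (star d)) ≤ LinearMap.ker (evalHom φ.symm g) :=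
    fun y hy => h y hy
  have hrk := rank_ker_evalHom_le hφ.symm hg0
  have : FiniteDimensional k (LinearMap.ker (evalHom φ.symm g)) :=
    Module.rank_lt_aleph0_iff.1 (hrk.trans_lt (Cardinal.natCast_lt_aleph0))
  have h1 := Submodule.finrank_mono hle
  have h2 : Module.finrank k (LinearMap.ker (evalHom φ.symm g)) ≤ g.deg :=
    Module.finrank_le_of_rank_le hrk
  omega

end TwPoly

namespace TwMat

open SkewPolynomial

variable {k H : Type*} [Field k] [Field H] [Algebra k H] {l : ℕ} {φ : H ≃ₐ[k] H}

lemma evalHom_algebraMap (c : k) (x : Fin l → H) :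
    evalHom l φ (algebraMap k (Matrix (Fin l) (Fin l) (TwPoly φ)) c) x = c • x := by
  ext i
  rw [evalHom_apply, Finset.sum_eq_single i]
  · rw [Matrix.algebraMap_matrix_apply, if_pos rfl, TwPoly.eval_algebraMap]; rfl
  · intro j _ hj
    rw [Matrix.algebraMap_matrix_apply, if_neg hj.symm, TwPoly.eval_zero]
  · simp

lemma star_algebraMap (c : k) :
    star (algebraMap k (Matrix (Fin l) (Fin l) (TwPoly φ)) c) = algebraMap k _ c := by
  ext1 i j
  rw [star, Matrix.algebraMap_matrix_apply, Matrix.algebraMap_matrix_apply]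
  simp only [eq_comm (a := j)]
  split_ifs
  · exact TwPoly.star_algebraMap c
  · exact TwPoly.star_zero

lemma star_one : star (1 : Matrix (Fin l) (Fin l) (TwPoly φ)) = 1 := by
  simpa using star_algebraMap (l := l) (φ := φ) 1

lemma star_diagonal (d : Fin l → TwPoly φ) :
    star (Matrix.diagonal d) = Matrix.diagonal fun i => TwPoly.star (d i) := by
  ext1 i j
  rw [star, Matrix.diagonal_apply, Matrix.diagonal_apply]
  simp only [eq_comm (a := j)]
  split_ifs with h
  · rw [h]
  · exact TwPoly.star_zero

/-- The adjoint of an invertible matrix. -/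
def starUnit (U : (Matrix (Fin l) (Fin l) (TwPoly φ))ˣ) :
    (Matrix (Fin l) (Fin l) (TwPoly φ.symm))ˣ :=
  ⟨star U.1, star U⁻¹.1, by rw [← star_mul, U.inv_mul, star_one], by
    rw [← star_mul, U.mul_inv, star_one]⟩

/-- The scalar matrix $c$ is central, because $\tau$ fixes $k$. Reading $\eta c$ once as
$1\cdot\eta\cdot c$ and once as $c\cdot\eta\cdot 1$ moves $c$ from $x$ to $y$. -/
lemma poonen_smul_left (η : Matrix (Fin l) (Fin l) (TwPoly φ)) (c : k)
    (x : LinearMap.ker (evalHom l φ η)) (y : LinearMap.ker (evalHom l φ.symm (star η))) :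
    poonen η (c • x) y = c • poonen η x y := by
  let S : Matrix (Fin l) (Fin l) (TwPoly φ) := algebraMap k _ c
  have hx : x.1 ∈ LinearMap.ker (evalHom l φ (η * S)) := by
    rw [LinearMap.mem_ker, map_mul, Module.End.mul_apply, evalHom_algebraMap, map_smul,
      LinearMap.mem_ker.1 x.2, smul_zero]
  have hy : y.1 ∈ LinearMap.ker (evalHom l φ.symm (star (η * S))) := by
    rw [LinearMap.mem_ker, star_mul, map_mul, Module.End.mul_apply, LinearMap.mem_ker.1 y.2,
      map_zero]
  rw [← poonen_smul_right,
    ← poonen_eq_poonen (η := η * S) (A := 1) (D := η) (B := S) (by rw [one_mul])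
      (x := ⟨x.1, hx⟩) (y := ⟨y.1, hy⟩) (evalHom_algebraMap c x.1)
      (by rw [star_one, map_one]; rfl),
    ← poonen_eq_poonen (η := η * S) (A := S) (D := η) (B := 1)
      (by rw [mul_one]; exact (Algebra.commutes c η).symm)
      (x := ⟨x.1, hx⟩) (y := ⟨y.1, hy⟩) (by rw [map_one]; rfl)
      (by rw [star_algebraMap]; exact evalHom_algebraMap c y.1)]

/-- The Poonen pairing as a `k`-bilinear form with values in the fixed field `k` of `φ`. -/
def poonenForm (hφ : FixedFieldEq φ) (η : Matrix (Fin l) (Fin l) (TwPoly φ)) :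
    LinearMap.ker (evalHom l φ η) →ₗ[k] LinearMap.ker (evalHom l φ.symm (star η)) →ₗ[k] k :=
  have hc (x y) : algebraMap k H (hφ _ (apply_poonen η x y)).choose = poonen η x y :=
    (hφ _ (apply_poonen η x y)).choose_spec
  LinearMap.mk₂ k (fun x y => (hφ _ (apply_poonen η x y)).choose)
    (fun x x' y => (algebraMap k H).injective <| by
      rw [map_add, hc, hc, hc, poonen_add_left])
    (fun c x y => (algebraMap k H).injective <| by
      rw [smul_eq_mul, map_mul, hc, hc, poonen_smul_left, Algebra.smul_def])
    (fun x y y' => (algebraMap k H).injective <| by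
      rw [map_add, hc, hc, hc, poonen_add_right])
    (fun c x y => (algebraMap k H).injective <| by
      rw [smul_eq_mul, map_mul, hc, hc, poonen_smul_right, Algebra.smul_def])

lemma algebraMap_poonenForm (hφ : FixedFieldEq φ) (η : Matrix (Fin l) (Fin l) (TwPoly φ))
    (x : LinearMap.ker (evalHom l φ η)) (y : LinearMap.ker (evalHom l φ.symm (star η))) :
    algebraMap k H (poonenForm hφ η x y) = poonen η x y :=
  (hφ _ (apply_poonen η x y)).choose_spec

lemma evalHom_diagonal (d : Fin l → TwPoly φ) (x : Fin l → H) (i : Fin l) :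
    evalHom l φ (Matrix.diagonal d) x i = TwPoly.eval (d i) (x i) := by
  rw [evalHom_apply, Finset.sum_eq_single i]
  · rw [Matrix.diagonal_apply_eq]
  · intro j _ hj
    rw [Matrix.diagonal_apply_ne _ hj.symm, TwPoly.eval_zero]
  · simp

/-- The kernel of a diagonal matrix is the product of the kernels of the diagonal entries. -/
def kerDiagonalEquiv (d : Fin l → TwPoly φ) : LinearMap.ker (evalHom l φ (Matrix.diagonal d)) ≃ₗ[k]
    ((i : Fin l) → LinearMap.ker (TwPoly.evalHom φ (d i))) where
  toFun x i := ⟨x.1 i, (evalHom_diagonal d x.1 i).symm.trans (congrFun x.2 i)⟩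
  invFun y := ⟨fun i => (y i).1, funext fun i => (evalHom_diagonal d _ i).trans (y i).2⟩
  left_inv _ := rfl
  right_inv _ := rfl
  map_add' _ _ := rfl
  map_smul' _ _ := rfl

/-- A zero diagonal entry would put a copy of $H$ into the kernel. -/
lemma ne_zero_of_finite_ker_diagonal (hinf : ¬ FiniteDimensional k H) (d : Fin l → TwPoly φ)
    [FiniteDimensional k (LinearMap.ker (evalHom l φ (Matrix.diagonal d)))] (i : Fin l) :
    d i ≠ 0 := by
  intro h
  refine hinf (FiniteDimensional.of_injective
    ((LinearMap.single k (fun _ => H) i).codRestrict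
      (LinearMap.ker (evalHom l φ (Matrix.diagonal d))) fun x => ?_) fun x y hxy => ?_)
  · rw [LinearMap.mem_ker]
    ext j
    rw [evalHom_diagonal]
    by_cases hj : j = i
    · subst hj; rw [h, TwPoly.eval_zero]; rfl
    · rw [LinearMap.single_apply, Pi.single_eq_of_ne hj]
      exact map_zero (TwPoly.evalHom φ (d j))
  · exact Pi.single_injective (M := fun _ => H) i (congrArg Subtype.val hxy)

lemma finite_ker_evalHom (hφ : FixedFieldEq φ) {p : TwPoly φ} (hp : p ≠ 0) :
    FiniteDimensional k (LinearMap.ker (TwPoly.evalHom φ p)) :=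
  Module.rank_lt_aleph0_iff.1
    ((TwPoly.rank_ker_evalHom_le hφ hp).trans_lt (Cardinal.natCast_lt_aleph0))

lemma finrank_ker_evalHom_le (hφ : FixedFieldEq φ) {p : TwPoly φ} (hp : p ≠ 0) :
    Module.finrank k (LinearMap.ker (TwPoly.evalHom φ p)) ≤ p.deg :=
  Module.finrank_le_of_rank_le (TwPoly.rank_ker_evalHom_le hφ hp)

lemma finrank_ker_diagonal (hφ : FixedFieldEq φ) {d : Fin l → TwPoly φ} (hd : ∀ i, d i ≠ 0) :
    Module.finrank k (LinearMap.ker (evalHom l φ (Matrix.diagonal d))) =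
      ∑ i, Module.finrank k (LinearMap.ker (TwPoly.evalHom φ (d i))) := by
  have := fun i => finite_ker_evalHom hφ (hd i)
  rw [(kerDiagonalEquiv d).finrank_eq, Module.finrank_pi_fintype]

lemma nonempty_kerEquiv {η D : Matrix (Fin l) (Fin l) (TwPoly φ)}
    {U V : (Matrix (Fin l) (Fin l) (TwPoly φ))ˣ} (h : U.1 * η * V.1 = D) :
    Nonempty (LinearMap.ker (evalHom l φ D) ≃ₗ[k] LinearMap.ker (evalHom l φ η)) := by
  have := LinearMap.ker_units_mul_mul_equiv (Units.map (evalHom l φ).toMonoidHom U)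
    (Units.map (evalHom l φ).toMonoidHom V) (evalHom l φ η)
  rw [← h, map_mul, map_mul]
  exact this

/-- The adjoint turns a diagonalization of $\eta$ into one of $\eta^*$, with the roles of $U$ and
$V$ exchanged; one diagonalization thus controls both kernels. -/
lemma star_mul_mul {η D : Matrix (Fin l) (Fin l) (TwPoly φ)}
    {U V : (Matrix (Fin l) (Fin l) (TwPoly φ))ˣ} (h : U.1 * η * V.1 = D) :
    (starUnit V).1 * star η * (starUnit U).1 = star D := by
  rw [← h, star_mul, star_mul, mul_assoc]
  rfl

/-- The dimensions of the kernels of `η` and `η*` agree if both are full. The diagonal entries of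
a diagonalization of `η` are nonzero, and their adjoints have kernels of full dimension. -/
lemma exists_diagonalization_of_fullDim (hφ : FixedFieldEq φ) (hinf : ¬ FiniteDimensional k H)
    {η : Matrix (Fin l) (Fin l) (TwPoly φ)} (h : KerFullDim η) (h' : KerStarFullDim η) :
    FiniteDimensional k (LinearMap.ker (evalHom l φ η)) ∧
    FiniteDimensional k (LinearMap.ker (evalHom l φ.symm (star η))) ∧
    Module.finrank k (LinearMap.ker (evalHom l φ η)) =
      Module.finrank k (LinearMap.ker (evalHom l φ.symm (star η))) ∧
    ∃ (U V : (Matrix (Fin l) (Fin l) (TwPoly φ))ˣ) (d : Fin l → TwPoly φ),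
      U.1 * η * V.1 = Matrix.diagonal d ∧ ∀ i, d i ≠ 0 ∧
        Module.finrank k (LinearMap.ker (TwPoly.evalHom φ.symm (TwPoly.star (d i)))) =
          (d i).deg := by
  obtain ⟨N, ⟨U, V, d, hd, hN⟩, hr⟩ := h
  obtain ⟨N', ⟨U', V', d', hd', hN'⟩, hr'⟩ := h'
  have f1 : FiniteDimensional k (LinearMap.ker (evalHom l φ η)) :=
    Module.rank_lt_aleph0_iff.1 (hr.trans_lt Cardinal.natCast_lt_aleph0)
  have f2 : FiniteDimensional k (LinearMap.ker (evalHom l φ.symm (star η))) :=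
    Module.rank_lt_aleph0_iff.1 (hr'.trans_lt Cardinal.natCast_lt_aleph0)
  obtain ⟨e⟩ := nonempty_kerEquiv hd
  obtain ⟨e'⟩ := nonempty_kerEquiv hd'
  obtain ⟨s⟩ := nonempty_kerEquiv (star_mul_mul hd)
  obtain ⟨s'⟩ := nonempty_kerEquiv (star_mul_mul hd')
  rw [star_diagonal] at s s'
  have hd0 : ∀ i, d i ≠ 0 := by
    have := Module.Finite.equiv e.symm
    exact ne_zero_of_finite_ker_diagonal hinf d
  have hs0' : ∀ i, TwPoly.star (d' i) ≠ 0 := by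
    have := Module.Finite.equiv s'.symm
    exact ne_zero_of_finite_ker_diagonal hinf _
  have hs0 : ∀ i, TwPoly.star (d i) ≠ 0 := fun i => (TwPoly.star_eq_zero_iff _).not.2 (hd0 i)
  have hd0' : ∀ i, d' i ≠ 0 := fun i => (TwPoly.star_eq_zero_iff _).not.1 (hs0' i)
  have r1 : Module.finrank k (LinearMap.ker (evalHom l φ η)) = ∑ i, (d i).deg := by
    rw [← hN]; exact Module.finrank_eq_of_rank_eq hr
  have r2 : Module.finrank k (LinearMap.ker (evalHom l φ.symm (star η))) = ∑ i, (d' i).deg := by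
    rw [← hN']; exact Module.finrank_eq_of_rank_eq hr'
  -- The two hypotheses may come with different diagonalizations $d$ and $d'$. The chain $\sum\deg
  -- d_i=\dim\ker\eta=\sum\dim\ker d'_i\le\sum\deg d'_i=\dim\ker\eta^*=\sum\dim\ker d_i^*\le\sum\deg
  -- d_i$ closes up and forces equality for each $d_i^*$.
  have r3 : ∑ i, (d i).deg ≤ ∑ i, (d' i).deg := by
    rw [← r1, ← e'.finrank_eq, finrank_ker_diagonal hφ hd0']
    exact Finset.sum_le_sum fun i _ => finrank_ker_evalHom_le hφ (hd0' i)
  have hle (i : Fin l) :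
      Module.finrank k (LinearMap.ker (TwPoly.evalHom φ.symm (TwPoly.star (d i)))) ≤ (d i).deg :=
    (finrank_ker_evalHom_le hφ.symm (hs0 i)).trans_eq (TwPoly.deg_star _)
  have r4 : ∑ i, (d' i).deg =
      ∑ i, Module.finrank k (LinearMap.ker (TwPoly.evalHom φ.symm (TwPoly.star (d i)))) := by
    rw [← r2, ← s.finrank_eq, finrank_ker_diagonal hφ.symm hs0]
  have r5 : ∑ i, Module.finrank k (LinearMap.ker (TwPoly.evalHom φ.symm (TwPoly.star (d i)))) =
      ∑ i, (d i).deg :=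
    le_antisymm (Finset.sum_le_sum fun i _ => hle i) (r3.trans_eq r4)
  refine ⟨f1, f2, by rw [r1, r2, r4, r5], U, V, d, hd, fun i => ⟨hd0 i, ?_⟩⟩
  exact (Finset.sum_eq_sum_iff_of_le fun i _ => hle i).1 r5 i (Finset.mem_univ i)

lemma exists_poonen_diagonal_ne_zero (hφ : FixedFieldEq φ) {d : Fin l → TwPoly φ}
    (hd : ∀ i, d i ≠ 0 ∧
      Module.finrank k (LinearMap.ker (TwPoly.evalHom φ.symm (TwPoly.star (d i)))) = (d i).deg)
    {x : LinearMap.ker (evalHom l φ (Matrix.diagonal d))} (hx : x ≠ 0) :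
    ∃ y, poonen (Matrix.diagonal d) x y ≠ 0 := by
  obtain ⟨i, hi⟩ : ∃ i, x.1 i ≠ 0 := by
    by_contra! h
    exact hx (Subtype.ext (funext h))
  obtain ⟨g, hg⟩ := exists_quotient _ x
  have hgi := congrFun hg i
  rw [star_diagonal, Matrix.vecMul_diagonal] at hgi
  -- For a diagonal matrix the quotient is computed entrywise, so a vector supported at one index
  -- $i$ with $x_i\ne0$ suffices as a witness.
  obtain ⟨y, hy, hy'⟩ := TwPoly.exists_eval_quotient_ne_zero hφ (hd i).1 (hd i).2 hi hgi
  have hker : Pi.single i y ∈ LinearMap.ker (evalHom l φ.symm (star (Matrix.diagonal d))) := by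
    rw [LinearMap.mem_ker, star_diagonal]
    ext j
    rw [evalHom_diagonal]
    by_cases hj : j = i
    · subst hj; rw [Pi.single_eq_same, hy]; rfl
    · rw [Pi.single_eq_of_ne hj]
      exact map_zero (TwPoly.evalHom φ.symm (TwPoly.star (d j)))
  refine ⟨⟨Pi.single i y, hker⟩, ?_⟩
  rw [poonen_eq hg]
  change rowEval g (Pi.single i y) ≠ 0
  rw [rowEval_apply, Finset.sum_eq_single i]
  · rwa [Pi.single_eq_same]
  · intro j _ hj
    rw [Pi.single_eq_of_ne hj]
    exact map_zero (TwPoly.evalHom φ.symm (g j))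
  · simp

/-- The Poonen pairing of a matrix is perfect if the kernels of the matrix and of its adjoint have
full dimension. -/
theorem isPerfPair_poonenForm (hφ : FixedFieldEq φ) (hinf : ¬ FiniteDimensional k H)
    {η : Matrix (Fin l) (Fin l) (TwPoly φ)} (h : KerFullDim η) (h' : KerStarFullDim η) :
    (poonenForm hφ η).IsPerfPair := by
  obtain ⟨f1, f2, hr, U, V, d, hd, hd'⟩ := exists_diagonalization_of_fullDim hφ hinf h h'
  have hη : η = U⁻¹.1 * Matrix.diagonal d * V⁻¹.1 := by
    rw [← hd, mul_assoc, mul_assoc, mul_assoc, V.mul_inv, mul_one, ← mul_assoc, U.inv_mul, one_mul]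
  have hinj : Function.Injective (poonenForm hφ η) := by
    rw [injective_iff_map_eq_zero]
    intro x hx
    by_contra hx0
    have hVV (z : Fin l → H) : evalHom l φ V.1 (evalHom l φ V⁻¹.1 z) = z := by
      rw [← Module.End.mul_apply, ← map_mul, V.mul_inv, map_one]; rfl
    have hx' : evalHom l φ V⁻¹.1 x.1 ∈ LinearMap.ker (evalHom l φ (Matrix.diagonal d)) := by
      rw [LinearMap.mem_ker, ← hd, map_mul, Module.End.mul_apply, hVV, map_mul,
        Module.End.mul_apply, LinearMap.mem_ker.1 x.2, map_zero]
    -- With $\eta=U^{-1}DV^{-1}$, the pairing of $x$ and $U^*y'$ equals that of $V^{-1}x$ and $y'$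
    -- for $D$.
    obtain ⟨y', hy'⟩ := exists_poonen_diagonal_ne_zero hφ hd' (x := ⟨_, hx'⟩) (by
      intro h0
      refine hx0 (Subtype.ext ?_)
      rw [← hVV x.1, show evalHom l φ V⁻¹.1 x.1 = 0 from congrArg Subtype.val h0, map_zero]
      rfl)
    have hUU (z : Fin l → H) :
        evalHom l φ.symm (star U⁻¹.1) (evalHom l φ.symm (star U.1) z) = z := by
      rw [← Module.End.mul_apply, ← map_mul, ← star_mul, U.mul_inv, star_one, map_one]; rfl
    have hy : evalHom l φ.symm (star U.1) y'.1 ∈ LinearMap.ker (evalHom l φ.symm (star η)) := by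
      rw [LinearMap.mem_ker, hη, star_mul, star_mul, map_mul, map_mul, Module.End.mul_apply,
        Module.End.mul_apply, hUU, LinearMap.mem_ker.1 y'.2, map_zero]
    refine hy' ?_
    rw [← poonen_eq_poonen hη (x := x) (y := ⟨_, hy⟩) rfl (hUU y'.1), ← algebraMap_poonenForm hφ,
      hx, LinearMap.zero_apply, map_zero]
  refine LinearMap.IsPerfPair.of_bijective _ ⟨hinj, ?_⟩
  exact (LinearMap.injective_iff_surjective_of_finrank_eq_finrank
    (hr.trans Subspace.dual_finrank_eq.symm)).1 hinj

end TwMat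

/-! ### The fixed field of `τ` -/

section Frobenius

variable {Fq : Type*} [Field Fq] [Fintype Fq] {L : Type*} [Field L] [Algebra Fq L]
  [Algebra.IsAlgebraic Fq L]

/-- The polynomial $X^q-X$ already splits over $\mathbb F_q$, so its roots in $L$ come from there.
-/
lemma fixedFieldEq_frobenius :
    FixedFieldEq (FiniteField.frobeniusAlgEquivOfAlgebraic Fq L) := fun x hx => by
  have hx' : x ^ Fintype.card Fq = x := by
    simpa [FiniteField.coe_frobeniusAlgEquivOfAlgebraic] using hx
  have h0 : (Polynomial.X ^ Fintype.card Fq - Polynomial.X : Fq[X]) ≠ 0 :=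
    FiniteField.X_pow_card_sub_X_ne_zero Fq Fintype.one_lt_card
  have hs : (Polynomial.X ^ Fintype.card Fq - Polynomial.X : Fq[X]).Splits := by
    rw [Polynomial.splits_iff_card_roots, FiniteField.roots_X_pow_card_sub_X,
      FiniteField.X_pow_card_sub_X_natDegree_eq Fq Fintype.one_lt_card]
    simp
  exact hs.mem_range_of_isRoot h0 (by simp [hx'])

/-- On a finite set, an `Fq`-linear map `L → L` is a combination of powers of the Frobenius. -/
lemma exists_eq_twistedOperator (T : L →ₗ[Fq] L) (s : Set L) (hs : s.Finite) :
    ∃ (n : ℕ) (c : ℕ → L), ∀ x ∈ s,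
      T x = twistedOperator (FiniteField.frobeniusAlgEquivOfAlgebraic Fq L) n c x := by
  set φ := FiniteField.frobeniusAlgEquivOfAlgebraic Fq L
  let V := Submodule.span Fq s
  have : FiniteDimensional Fq V := FiniteDimensional.span_of_finite Fq hs
  let b := Module.finBasis Fq V
  let ext (c : Fin (Module.finrank Fq V) → L) (i : ℕ) : L :=
    if h : i < Module.finrank Fq V then c ⟨i, h⟩ else 0
  -- The Moore matrix of a basis of the span $V$ of $s$: coefficients of an operator of order less
  -- than $\dim V$ are sent to its values on the basis. Once this square system is injective, any
  -- prescribed values are attained.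
  let Φ : (Fin (Module.finrank Fq V) → L) →ₗ[L] (Fin (Module.finrank Fq V) → L) :=
    LinearMap.pi fun i => ∑ j, LinearMap.toSpanSingleton L L ((φ ^ j.1 : L ≃ₐ[Fq] L) (b i)) ∘ₗ
      LinearMap.proj j
  have hΦ (c : Fin (Module.finrank Fq V) → L) (i : Fin (Module.finrank Fq V)) :
      Φ c i = twistedOperator φ (Module.finrank Fq V) (ext c) (b i) := by
    rw [twistedOperator_apply, Finset.sum_range]
    simp [Φ, ext, LinearMap.sum_apply]
  have hker : Function.Injective Φ := by
    rw [injective_iff_map_eq_zero]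
    intro c hc
    by_contra hc0
    obtain ⟨i, hi⟩ := Function.ne_iff.1 hc0
    have hn : Module.finrank Fq V = (Module.finrank Fq V - 1) + 1 := by
      have := i.2; omega
    -- A nonzero $c$ in the kernel of $\Phi$ would give a nonzero operator that kills $V$, while
    -- operators of this order have kernels of dimension at most $\dim V-1$.
    have hle : V ≤ LinearMap.ker (twistedOperator φ (Module.finrank Fq V) (ext c)) := by
      have h (v : V) : twistedOperator φ (Module.finrank Fq V) (ext c) v = 0 := by
        suffices twistedOperator φ (Module.finrank Fq V) (ext c) ∘ₗ V.subtype = 0 from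
          congrArg (fun g => g v) this
        refine b.ext fun i => ?_
        rw [LinearMap.comp_apply, Submodule.subtype_apply, ← hΦ, hc]; rfl
      exact fun v hv => h ⟨v, hv⟩
    have h1 : Module.rank Fq V ≤ (Module.finrank Fq V - 1 : ℕ) := by
      refine (Submodule.rank_mono hle).trans ?_
      have := rank_ker_twistedOperator_le (φ := φ) fixedFieldEq_frobenius
        (Module.finrank Fq V - 1) (ext c) ⟨i.1, by have := i.2; omega, by
          simp only [ext, i.2, dif_pos]; exact hi⟩
      rwa [← hn] at this
    have h2 := Module.finrank_le_of_rank_le h1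
    omega
  obtain ⟨c, hc⟩ := LinearMap.injective_iff_surjective.1 hker fun i => T (b i)
  refine ⟨Module.finrank Fq V, ext c, fun x hx => ?_⟩
  have : T ∘ₗ V.subtype = twistedOperator φ (Module.finrank Fq V) (ext c) ∘ₗ V.subtype := by
    refine b.ext fun i => ?_
    rw [LinearMap.comp_apply, LinearMap.comp_apply, Submodule.subtype_apply, ← hΦ, hc]
  exact congrArg (fun g => g ⟨x, Submodule.subset_span hx⟩) this

end Frobenius

/-! ### Quotients of power series fixed by the Frobenius -/

namespace MvPowerSeries

variable {σ : Type*} {Fq : Type*} [Field Fq] [Fintype Fq] {L : Type*} [Field L] [Algebra Fq L]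
  [Algebra.IsAlgebraic Fq L]

/-- If `p / q` is fixed by the Frobenius of the coefficients, then `p / q = T(p) / T(q)` for each
`Fq`-linear operator `T` on the coefficients. -/
lemma sum_coeff_mul_eq (p q : MvPowerSeries σ L)
    (h : map (FiniteField.frobeniusAlgEquivOfAlgebraic Fq L : L →+* L) p * q =
      p * map (FiniteField.frobeniusAlgEquivOfAlgebraic Fq L : L →+* L) q)
    (hq : q ≠ 0) (T : L →ₗ[Fq] L) (m : σ →₀ ℕ) :
    open scoped Classical in
    ∑ a ∈ Finset.HasAntidiagonal.antidiagonal m, T (coeff a.1 p) * coeff a.2 q =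
      ∑ a ∈ Finset.HasAntidiagonal.antidiagonal m, coeff a.1 p * T (coeff a.2 q) := by
  classical
  set φ := FiniteField.frobeniusAlgEquivOfAlgebraic Fq L
  have hpow (i : ℕ) : map ((φ ^ i : L ≃ₐ[Fq] L) : L →+* L) p * q =
      p * map ((φ ^ i : L ≃ₐ[Fq] L) : L →+* L) q := by
    induction i with
    | zero =>
      have : ((φ ^ 0 : L ≃ₐ[Fq] L) : L →+* L) = RingHom.id L := rfl
      rw [this, map_id]; rfl
    | succ i ih =>
      have hm (r : MvPowerSeries σ L) : map ((φ ^ (i + 1) : L ≃ₐ[Fq] L) : L →+* L) r =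
          map (φ : L →+* L) (map ((φ ^ i : L ≃ₐ[Fq] L) : L →+* L) r) := by
        ext a
        rw [coeff_map, coeff_map, coeff_map, pow_succ']; rfl
      have ih' := congrArg (map (φ : L →+* L)) ih
      rw [map_mul, map_mul, ← hm, ← hm] at ih'
      have hq' : map (φ : L →+* L) q ≠ 0 := by
        intro h0
        refine hq (MvPowerSeries.ext fun a => ?_)
        have := congrArg (coeff a) h0
        rw [coeff_map, coeff_zero] at this
        rw [coeff_zero]
        exact (map_eq_zero_iff _ (RingHom.injective _)).1 this
      -- After multiplication by $\varphi(q)$, the twist of the $i$-th relation and the original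
      -- relation combine; $\varphi(q)$ is then cancelled.
      refine mul_right_cancel₀ hq' ?_
      rw [mul_right_comm, ih', mul_right_comm, h, mul_assoc, mul_assoc, mul_comm (map _ q)]
  -- Only finitely many coefficients of $p$ and $q$ enter the coefficient at $m$. On them $T$ is a
  -- combination of powers of $\varphi$, for which the identity is `hpow`; the combination may
  -- depend on $m$.
  obtain ⟨n, c, hc⟩ := exists_eq_twistedOperator T
    (((Finset.HasAntidiagonal.antidiagonal m).image fun a => coeff a.1 p) ∪
      ((Finset.HasAntidiagonal.antidiagonal m).image fun a => coeff a.2 q) : Finset L) (Finset.finite_toSet _)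
  have h1 : ∑ a ∈ Finset.HasAntidiagonal.antidiagonal m, T (coeff a.1 p) * coeff a.2 q =
      ∑ i ∈ Finset.range n, c i * coeff m (map ((φ ^ i : L ≃ₐ[Fq] L) : L →+* L) p * q) := by
    simp only [coeff_mul, Finset.mul_sum]
    rw [Finset.sum_comm]
    refine Finset.sum_congr rfl fun a ha => ?_
    rw [hc _ (Finset.mem_coe.2 (Finset.mem_union_left _ (Finset.mem_image_of_mem _ ha))),
      twistedOperator_apply, Finset.sum_mul]
    exact Finset.sum_congr rfl fun i _ => mul_assoc _ _ _
  have h2 : ∑ a ∈ Finset.HasAntidiagonal.antidiagonal m, coeff a.1 p * T (coeff a.2 q) =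
      ∑ i ∈ Finset.range n, c i * coeff m (p * map ((φ ^ i : L ≃ₐ[Fq] L) : L →+* L) q) := by
    simp only [coeff_mul, Finset.mul_sum]
    rw [Finset.sum_comm]
    refine Finset.sum_congr rfl fun a ha => ?_
    rw [hc _ (Finset.mem_coe.2 (Finset.mem_union_right _ (Finset.mem_image_of_mem _ ha))),
      twistedOperator_apply, Finset.mul_sum]
    exact Finset.sum_congr rfl fun i _ => mul_left_comm _ _ _
  rw [h1, h2]
  simp only [hpow]

/-- If `p / q` is fixed by the Frobenius of the coefficients, then it is the quotient of series
with coefficients `T(pₐ)` and `T(qₐ)`, for some linear form `T`. -/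
lemma exists_dual_mul_eq_mul (p q : MvPowerSeries σ L)
    (h : map (FiniteField.frobeniusAlgEquivOfAlgebraic Fq L : L →+* L) p * q =
      p * map (FiniteField.frobeniusAlgEquivOfAlgebraic Fq L : L →+* L) q)
    (hq : q ≠ 0) : ∃ T : L →ₗ[Fq] Fq, (∃ a, T (coeff a q) ≠ 0) ∧
      ∀ P Q : MvPowerSeries σ Fq, (∀ a, coeff a P = T (coeff a p)) →
        (∀ a, coeff a Q = T (coeff a q)) →
        map (algebraMap Fq L) P * q = p * map (algebraMap Fq L) Q := by
  classical
  obtain ⟨a, ha⟩ : ∃ a, coeff a q ≠ 0 := by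
    by_contra! h0
    exact hq (MvPowerSeries.ext h0)
  obtain ⟨T, hT⟩ : ∃ T : Module.Dual Fq L, T (coeff a q) ≠ 0 := by
    by_contra! h0
    exact ha ((Module.forall_dual_apply_eq_zero_iff Fq _).1 h0)
  refine ⟨T, ⟨a, hT⟩, fun P Q hP hQ => MvPowerSeries.ext fun m => ?_⟩
  rw [coeff_mul, coeff_mul]
  simp only [coeff_map, hP, hQ]
  exact sum_coeff_mul_eq p q h hq (Algebra.linearMap Fq L ∘ₗ T) m

end MvPowerSeries

/-! ### The fixed field of $\tau$ is $k$, and $H$ has infinite degree over it -/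

namespace FZ

variable (κ : ScalarKind) (n : ℕ)

lemma frac_map_algebraMap {R S : Type*} [CommRing R] [IsDomain R] [CommRing S] [IsDomain S]
    {g : R →+* S} (hg : Function.Injective g) (a : R) :
    IsFractionRing.map (K := FractionRing R) (L := FractionRing S) hg (algebraMap R _ a) =
      algebraMap S _ (g a) := by
  simp [IsFractionRing.map]

lemma exists_frac_map_eq_of_frac_map_eq {R S : Type*} [CommRing R] [IsDomain R] [CommRing S]
    [IsDomain S] {g : R →+* S} (hg : Function.Injective g) {f : S →+* S} (hf : Function.Injective f)
    (h : ∀ p q : S, q ≠ 0 → f p * q = p * f q → ∃ P Q : R, g Q ≠ 0 ∧ g P * q = p * g Q)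
    (x : FractionRing S)
    (hx : IsFractionRing.map (K := FractionRing S) (L := FractionRing S) hf x = x) :
    ∃ y, IsFractionRing.map (K := FractionRing R) (L := FractionRing S) hg y = x := by
  obtain ⟨p, q, hq, rfl⟩ := IsFractionRing.div_surjective (A := S) x
  have hq0 : q ≠ 0 := nonZeroDivisors.ne_zero hq
  have hinj := IsFractionRing.injective S (FractionRing S)
  have hne {s : S} (hs : s ≠ 0) : algebraMap S (FractionRing S) s ≠ 0 :=
    (map_ne_zero_iff _ hinj).2 hs
  rw [map_div₀, frac_map_algebraMap, frac_map_algebraMap,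
    div_eq_div_iff (hne ((map_ne_zero_iff _ hf).2 hq0)) (hne hq0), ← map_mul, ← map_mul] at hx
  obtain ⟨P, Q, hQ, hPQ⟩ := h p q hq0 (hinj hx)
  refine ⟨algebraMap R _ P / algebraMap R _ Q, ?_⟩
  rw [map_div₀, frac_map_algebraMap, frac_map_algebraMap, div_eq_div_iff (hne hQ) (hne hq0),
    ← map_mul, ← map_mul, hPQ]

lemma coe_map {F F' : Type*} [Field F] [Field F'] (g : F →+* F') (r : MvPolynomial (Fin n) F) :
    ((MvPolynomial.map g r : MvPolynomial (Fin n) F') : MvPowerSeries (Fin n) F') =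
      MvPowerSeries.map g r := by
  ext a
  rw [MvPolynomial.coeff_coe, MvPowerSeries.coeff_map, MvPolynomial.coeff_coe]
  exact MvPolynomial.coeff_map _ _ _

/-- A linear form, applied to the coefficients of a polynomial. -/
def mapDual {k L : Type*} [Field k] [Field L] [Algebra k L] (T : L →ₗ[k] k)
    (p : MvPolynomial (Fin n) L) : MvPolynomial (Fin n) k :=
  ∑ m ∈ p.support, MvPolynomial.monomial m (T (p.coeff m))

lemma coeff_mapDual {k L : Type*} [Field k] [Field L] [Algebra k L] (T : L →ₗ[k] k)
    (p : MvPolynomial (Fin n) L) (m : Fin n →₀ ℕ) :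
    (mapDual n T p).coeff m = T (p.coeff m) := by
  classical
  rw [mapDual, MvPolynomial.coeff_sum]
  simp only [MvPolynomial.coeff_monomial, Finset.sum_ite_eq', MvPolynomial.mem_support_iff]
  split_ifs with h
  · rfl
  · rw [not_not] at h; rw [h, map_zero]

variable {Fq : Type*} [Field Fq] [Fintype Fq] {L : Type*} [Field L]
  [Algebra Fq L] [Algebra.IsAlgebraic Fq L]

/-- The elements of `L(Z)` or `L((Z))` that are fixed by `τ` are those of `k`. -/
theorem fixedFieldEq_tau : FixedFieldEq (tau κ n Fq L) := by
  match κ with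
  | .rational =>
    intro x hx
    refine exists_frac_map_eq_of_frac_map_eq (MvPolynomial.map_injective _ (RingHom.injective _))
      (MvPolynomial.map_injective _ (RingHom.injective _)) (fun p q hq h => ?_) x hx
    -- Polynomials are treated as power series; a linear form applied to the coefficients keeps them
    -- polynomials, so the resulting quotient is again rational.
    have h' := congrArg (fun r : MvPolynomial (Fin n) L => (r : MvPowerSeries (Fin n) L)) h
    simp only [MvPolynomial.coe_mul] at h'
    rw [coe_map, coe_map] at h'
    obtain ⟨T, ⟨a, ha⟩, hT⟩ := MvPowerSeries.exists_dual_mul_eq_mul (p : MvPowerSeries (Fin n) L) q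
      h' (by simpa using hq)
    refine ⟨mapDual n T p, mapDual n T q, fun h0 => ?_, ?_⟩
    · have := congrArg (MvPolynomial.coeff a) h0
      rw [MvPolynomial.coeff_map, MvPolynomial.coeff_zero, coeff_mapDual] at this
      exact ha ((map_eq_zero_iff _ (RingHom.injective _)).1 this)
    · refine MvPolynomial.coe_injective _ _ ?_
      rw [MvPolynomial.coe_mul, MvPolynomial.coe_mul, coe_map, coe_map]
      exact hT _ _ (fun a => by simp [coeff_mapDual]) fun a => by simp [coeff_mapDual]
  | .laurent =>
    intro x hx
    refine exists_frac_map_eq_of_frac_map_eq (mvPowerSeries_map_injective n _)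
      (mvPowerSeries_map_injective n _) (fun p q hq h => ?_) x hx
    obtain ⟨T, ⟨a, ha⟩, hT⟩ := MvPowerSeries.exists_dual_mul_eq_mul p q h hq
    let Q : MvPowerSeries (Fin n) Fq := fun a => T (MvPowerSeries.coeff a q)
    refine ⟨fun a => T (MvPowerSeries.coeff a p), Q,
      fun h0 => ?_, hT _ _ (fun _ => rfl) fun _ => rfl⟩
    have := congrArg (MvPowerSeries.coeff a) h0
    rw [MvPowerSeries.coeff_map, MvPowerSeries.coeff_zero] at this
    exact ha ((map_eq_zero_iff _ (RingHom.injective _)).1 this)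
  | .iteratedLaurent =>
    intro x hx
    let x' : HahnSeries (Lex (Fin n → ℤ)) L := x
    -- Here no quotients occur: $\tau$ acts coefficientwise, so each coefficient is fixed by the
    -- Frobenius.
    have h (a : Lex (Fin n → ℤ)) : x'.coeff a ∈ (algebraMap Fq L).range :=
      fixedFieldEq_frobenius _ (congrArg (fun y : HahnSeries (Lex (Fin n → ℤ)) L => y.coeff a) hx)
    choose c hc using h
    refine ⟨(⟨c, ?_⟩ : HahnSeries (Lex (Fin n → ℤ)) Fq), HahnSeries.ext (funext hc)⟩
    refine x'.isPWO_support.mono fun a ha => ?_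
    rw [HahnSeries.mem_support, ← hc]
    exact (map_ne_zero_iff _ (RingHom.injective _)).2 ha

lemma map_const {F F' : Type*} [Field F] [Field F'] (g : F →+* F') (a : F) :
    map κ n g (const κ n F a) = const κ n F' (g a) := by
  match κ with
  | .rational =>
    refine (frac_map_algebraMap (MvPolynomial.map_injective g g.injective)
      (MvPolynomial.C a)).trans ?_
    rw [MvPolynomial.map_C]; rfl
  | .laurent =>
    refine (frac_map_algebraMap (mvPowerSeries_map_injective n g) (MvPowerSeries.C a)).trans ?_
    rw [MvPowerSeries.map_C]; rfl
  | .iteratedLaurent => exact HahnSeries.map_C _ _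

lemma tau_pow_const (i : ℕ) (a : L) :
    (tau κ n Fq L ^ i : FZ κ n L ≃ₐ[FZ κ n Fq] FZ κ n L) (const κ n L a) =
      const κ n L (a ^ Fintype.card Fq ^ i) := by
  induction i with
  | zero => rw [pow_zero, pow_zero, pow_one]; rfl
  | succ i ih =>
    rw [pow_succ', AlgEquiv.mul_apply, ih]
    refine (map_const κ n _ _).trans (congrArg _ ?_)
    change FiniteField.frobeniusAlgEquivOfAlgebraic Fq L _ = _
    rw [FiniteField.coe_frobeniusAlgEquivOfAlgebraic, pow_succ (Fintype.card Fq), pow_mul]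

/-- For an infinite field `L`, the field `L(Z)` or `L((Z))` has infinite degree over `k`. -/
theorem not_finiteDimensional [Infinite L] : ¬ FiniteDimensional (FZ κ n Fq) (FZ κ n L) := by
  intro h
  -- A finite extension has finitely many automorphisms, so $\tau$ would have finite order $i$; on
  -- constants this gives $a^{q^i}=a$ for all $a$ in the infinite field $L$.
  have : Finite (FZ κ n L ≃ₐ[FZ κ n Fq] FZ κ n L) := inferInstance
  obtain ⟨i, hi, hi'⟩ := (isOfFinOrder_of_finite (tau κ n Fq L)).exists_pow_eq_one
  have h1 (a : L) : a ^ Fintype.card Fq ^ i = a := by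
    refine (const κ n L).injective ?_
    rw [← tau_pow_const, hi']; rfl
  have hcard : 1 < Fintype.card Fq ^ i := Nat.one_lt_pow hi.ne' Fintype.one_lt_card
  refine FiniteField.X_pow_card_sub_X_ne_zero L hcard (Polynomial.funext fun a => ?_)
  simp [h1]

end FZ

/-! ### Galois equivariance of the Poonen pairing -/

namespace TwPoly

open SkewPolynomial

variable {k H H' : Type*} [Field k] [Field H] [Algebra k H] [Field H'] [Algebra k H']
  {φ : H ≃ₐ[k] H} {φ' : H' ≃ₐ[k] H'}

lemma map_monomial (j : H →ₐ[k] H') (hj : ∀ x, j (φ x) = φ' (j x)) (n : ℕ) (a : Tw φ) :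
    map j hj (monomial n a) = monomial n (Tw.of φ' (j (Tw.val a))) := by
  refine SkewPolynomial.ext fun m => ?_
  rw [coeff_map, coeff_monomial, coeff_monomial]
  split_ifs <;> simp

lemma map_algebraMap (j : H →ₐ[k] H') (hj : ∀ x, j (φ x) = φ' (j x)) (c : k) :
    map j hj (algebraMap k (TwPoly φ) c) = algebraMap k (TwPoly φ') c := by
  rw [algebraMap_eq_monomial, map_monomial]
  exact congrArg (fun x => monomial 0 (Tw.of φ' x)) (AlgHom.commutes j c)

lemma eval_map (j : H →ₐ[k] H') (hj : ∀ x, j (φ x) = φ' (j x)) (p : TwPoly φ) (x : H) :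
    eval (map j hj p) (j x) = j (eval p x) := by
  have hpow (n : ℕ) : j ((φ ^ n : H ≃ₐ[k] H) x) = (φ' ^ n : H' ≃ₐ[k] H') (j x) := by
    induction n with
    | zero => rfl
    | succ n ih =>
      rw [pow_succ', pow_succ']
      exact (hj _).trans (congrArg φ' ih)
  induction p using induct with
  | h1 n a => rw [map_monomial, eval_monomial, eval_monomial, map_mul, hpow]; rfl
  | h2 p q hp hq => rw [map_add, eval_add, eval_add, map_add, hp, hq]

lemma map_eq_self (Γ : H →ₐ[k] H) (hφ : ∀ x, Γ (φ x) = φ (Γ x)) (p : TwPoly φ)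
    (hp : ∀ n, Γ (Tw.val (p.coeff n)) = Tw.val (p.coeff n)) : map Γ hφ p = p :=
  SkewPolynomial.ext fun n => by rw [coeff_map, hp]; rfl

end TwPoly

namespace TwMat

open SkewPolynomial

variable {k H : Type*} [Field k] [Field H] [Algebra k H] {l : ℕ} {φ : H ≃ₐ[k] H}

/-- The Poonen pairing of `η` is equivariant under automorphisms that fix the coefficients of the
adjoint of `η`. -/
lemma poonen_map (Γ : H →ₐ[k] H) (hΓ : ∀ x, Γ (φ.symm x) = φ.symm (Γ x))
    {η : Matrix (Fin l) (Fin l) (TwPoly φ)}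
    (hη : ∀ i j n, Γ (Tw.val ((star η i j).coeff n)) = Tw.val ((star η i j).coeff n))
    {x x' : LinearMap.ker (evalHom l φ η)} {y y' : LinearMap.ker (evalHom l φ.symm (star η))}
    (hx : ∀ i, x'.1 i = Γ (x.1 i)) (hy : ∀ i, y'.1 i = Γ (y.1 i)) :
    poonen η x' y' = Γ (poonen η x y) := by
  obtain ⟨g, hg⟩ := exists_quotient η x
  have hX : TwPoly.map Γ hΓ X = X := by
    rw [← monomial_one_one_eq_X, TwPoly.map_monomial, map_one, map_one, map_one]
  -- Since $\Gamma$ commutes with $\sigma$ and fixes the coefficients of $\eta^*$, applying it to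
  -- $x^{\mathsf T}\eta^*=(1-\sigma)g_x$ shows $g_{\Gamma x}=\Gamma(g_x)$.
  have hg' : Matrix.vecMul (row φ x'.1) (star η) = fun i => (1 - X) * TwPoly.map Γ hΓ (g i) := by
    ext1 i
    have h := congrArg (TwPoly.map Γ hΓ) (congrFun hg i)
    rw [map_mul, map_sub, map_one, hX] at h
    rw [← h]
    simp only [Matrix.vecMul, dotProduct, map_sum, map_mul]
    refine Finset.sum_congr rfl fun j _ => ?_
    rw [TwPoly.map_eq_self Γ hΓ _ (hη j i)]
    congr 1
    change monomial 0 _ = TwPoly.map Γ hΓ (monomial 0 _)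
    rw [TwPoly.map_monomial, hx]
    rfl
  rw [poonen_eq hg', poonen_eq hg, rowEval_apply, rowEval_apply, map_sum]
  exact Finset.sum_congr rfl fun i _ => by rw [hy, TwPoly.eval_map]

/-! ### The pairing on torsion points and on Tate modules -/

namespace Points

instance {A : Type*} [CommRing A] (ρ : A →+* Matrix (Fin l) (Fin l) (TwPoly φ)) :
    Module k (Points ρ) := inferInstanceAs (Module k (Fin l → H))

variable {ρ : k[X] →+* Matrix (Fin l) (Fin l) (TwPoly φ)}

lemma C_smul (hρ : ∀ c, ρ (Polynomial.C c) = algebraMap k _ c) (c : k) (x : Points ρ) :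
    Polynomial.C c • x = c • x :=
  (congrArg (fun T => evalHom l φ T x) (hρ c)).trans (evalHom_algebraMap c x)

lemma isScalarTower (hρ : ∀ c, ρ (Polynomial.C c) = algebraMap k _ c) :
    IsScalarTower k k[X] (Points ρ) where
  smul_assoc c p x := by
    rw [Polynomial.smul_eq_C_mul, mul_smul, C_smul hρ]

lemma starHom_C (hρ : ∀ c, ρ (Polynomial.C c) = algebraMap k _ c) (c : k) :
    starHom ρ (Polynomial.C c) = algebraMap k _ c :=
  (congrArg star (hρ c)).trans (star_algebraMap c)

/-- The Poonen pairing on `a`-torsion, with values in `k`. -/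
def form (hφ : FixedFieldEq φ) (ρ : k[X] →+* Matrix (Fin l) (Fin l) (TwPoly φ)) (a : k[X])
    (x : Submodule.torsionBy k[X] (Points ρ) a)
    (y : Submodule.torsionBy k[X] (Points (starHom ρ)) a) : k :=
  poonenForm hφ (ρ a) (torsionKer a x) (torsionKerStar a y)

variable (hφ : FixedFieldEq φ)

lemma form_add_left (a : k[X]) (x x' : Submodule.torsionBy k[X] (Points ρ) a)
    (y : Submodule.torsionBy k[X] (Points (starHom ρ)) a) :
    form hφ ρ a (x + x') y = form hφ ρ a x y + form hφ ρ a x' y :=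
  LinearMap.map_add₂ (poonenForm hφ (ρ a)) (torsionKer a x) (torsionKer a x') (torsionKerStar a y)

lemma form_add_right (a : k[X]) (x : Submodule.torsionBy k[X] (Points ρ) a)
    (y y' : Submodule.torsionBy k[X] (Points (starHom ρ)) a) :
    form hφ ρ a x (y + y') = form hφ ρ a x y + form hφ ρ a x y' :=
  map_add (poonenForm hφ (ρ a) (torsionKer a x)) (torsionKerStar a y) (torsionKerStar a y')

lemma form_C_smul (hρ : ∀ c, ρ (Polynomial.C c) = algebraMap k _ c) (a : k[X]) (c : k)
    (x : Submodule.torsionBy k[X] (Points ρ) a)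
    (y : Submodule.torsionBy k[X] (Points (starHom ρ)) a) :
    form hφ ρ a (Polynomial.C c • x) y = c * form hφ ρ a x y := by
  have h : torsionKer a (Polynomial.C c • x) = c • torsionKer a x :=
    Subtype.ext (C_smul hρ c x.1)
  rw [form, h]
  exact LinearMap.map_smul₂ (poonenForm hφ (ρ a)) c (torsionKer a x) (torsionKerStar a y)

/-- The pairings of `a c b`-torsion and of `c`-torsion are compatible. -/
lemma form_eq_form {a b c d : k[X]} (h : d = a * c * b)
    {x : Submodule.torsionBy k[X] (Points ρ) d}
    {y : Submodule.torsionBy k[X] (Points (starHom ρ)) d}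
    {x' : Submodule.torsionBy k[X] (Points ρ) c}
    {y' : Submodule.torsionBy k[X] (Points (starHom ρ)) c}
    (hx : b • x.1 = x'.1) (hy : a • y.1 = y'.1) : form hφ ρ d x y = form hφ ρ c x' y' :=
  (algebraMap k H).injective <| by
    rw [form, form, algebraMap_poonenForm, algebraMap_poonenForm]
    exact poonen_eq_poonen (by rw [h, map_mul, map_mul]) hx hy

/-- Both sides are the pairing of $x$ and $y$ as $ab$-torsion, by the factorizations $1\cdot a\cdot
b$ and $b\cdot a\cdot1$. -/
lemma form_smul_left (a b : k[X]) (x : Submodule.torsionBy k[X] (Points ρ) a)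
    (y : Submodule.torsionBy k[X] (Points (starHom ρ)) a) :
    form hφ ρ a (b • x) y = form hφ ρ a x (b • y) := by
  have hx : x.1 ∈ Submodule.torsionBy k[X] (Points ρ) (a * b) := by
    rw [Submodule.mem_torsionBy_iff, mul_comm, mul_smul,
      (Submodule.mem_torsionBy_iff _ _).1 x.2, smul_zero]
  have hy : y.1 ∈ Submodule.torsionBy k[X] (Points (starHom ρ)) (a * b) := by
    rw [Submodule.mem_torsionBy_iff, mul_comm, mul_smul,
      (Submodule.mem_torsionBy_iff _ _).1 y.2, smul_zero]
  rw [← form_eq_form hφ (a := 1) (b := b) (c := a) (by rw [one_mul]) (x := ⟨x.1, hx⟩)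
    (y := ⟨y.1, hy⟩) rfl (one_smul _ _)]
  exact form_eq_form hφ (a := b) (b := 1) (by ring) (one_smul _ _) rfl

/-- The pairing of `a`-torsion that takes `x` and `y` to the function `b ↦ ⟨b • x, y⟩`. -/
def dualPairing (hρ : ∀ c, ρ (Polynomial.C c) = algebraMap k _ c) (a : k[X]) :
    Submodule.torsionBy k[X] (Points ρ) a →ₗ[k[X]]
      Submodule.torsionBy k[X] (Points (starHom ρ)) a →ₗ[k[X]] PolyDual k :=
  LinearMap.mk₂ k[X] (fun x y => show k[X] →ₗ[k] k from
      { toFun := fun b => form hφ ρ a (b • x) y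
        map_add' := fun b b' => by rw [add_smul, form_add_left]
        map_smul' := fun c b => by
          rw [Polynomial.smul_eq_C_mul, mul_smul, form_C_smul hφ hρ]; rfl })
    (fun x x' y => DFunLike.ext _ _ fun b => by
      change form hφ ρ a (b • (x + x')) y = form hφ ρ a (b • x) y + form hφ ρ a (b • x') y
      rw [smul_add, form_add_left])
    (fun c x y => DFunLike.ext _ _ fun b => by
      change form hφ ρ a (b • c • x) y = form hφ ρ a ((c * b) • x) y
      rw [smul_smul, mul_comm])
    (fun x y y' => DFunLike.ext _ _ fun b => form_add_right hφ a _ y y')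
    (fun c x y => DFunLike.ext _ _ fun b => by
      change form hφ ρ a (b • x) (c • y) = form hφ ρ a ((c * b) • x) y
      rw [← form_smul_left, mul_smul])

lemma dualPairing_apply (hρ : ∀ c, ρ (Polynomial.C c) = algebraMap k _ c) (a b : k[X])
    (x : Submodule.torsionBy k[X] (Points ρ) a)
    (y : Submodule.torsionBy k[X] (Points (starHom ρ)) a) :
    dualPairing hφ hρ a x y b = form hφ ρ a (b • x) y := rfl

lemma algebraMap_dualPairing (hρ : ∀ c, ρ (Polynomial.C c) = algebraMap k _ c) (a b : k[X])
    (x : Submodule.torsionBy k[X] (Points ρ) a)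
    (y : Submodule.torsionBy k[X] (Points (starHom ρ)) a) :
    algebraMap k H (dualPairing hφ hρ a x y b) = pairing ρ a (b • x) y := by
  rw [dualPairing_apply, form, algebraMap_poonenForm, pairing]

lemma dualPairing_apply_one (hρ : ∀ c, ρ (Polynomial.C c) = algebraMap k _ c) (a : k[X])
    (x : Submodule.torsionBy k[X] (Points ρ) a)
    (y : Submodule.torsionBy k[X] (Points (starHom ρ)) a) :
    dualPairing hφ hρ a x y 1 = form hφ ρ a x y := by
  rw [dualPairing_apply, one_smul]

lemma dualPairing_eq_dualPairing (hρ : ∀ c, ρ (Polynomial.C c) = algebraMap k _ c)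
    {a b c d : k[X]} (h : d = a * c * b)
    {x : Submodule.torsionBy k[X] (Points ρ) d}
    {y : Submodule.torsionBy k[X] (Points (starHom ρ)) d}
    {x' : Submodule.torsionBy k[X] (Points ρ) c}
    {y' : Submodule.torsionBy k[X] (Points (starHom ρ)) c}
    (hx : b • x.1 = x'.1) (hy : a • y.1 = y'.1) :
    dualPairing hφ hρ d x y = dualPairing hφ hρ c x' y' :=
  DFunLike.ext _ _ fun e => by
    rw [dualPairing_apply, dualPairing_apply]
    refine form_eq_form hφ h ?_ hy
    rw [Submodule.coe_smul, Submodule.coe_smul, smul_comm, hx]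

/-- The factorization $a\cdot a^m\cdot1$ of $a^{m+1}$ moves the multiplication by $a$ to the second
argument; $1\cdot a^m\cdot a$ does the same for the flipped pairing. -/
lemma adjointInclusion_dualPairing (hρ : ∀ c, ρ (Polynomial.C c) = algebraMap k _ c) (a : k[X]) :
    TateModule.AdjointInclusion (l := a) fun m => dualPairing hφ hρ (a ^ m) :=
  fun m x y hx hx' hy hy' =>
    dualPairing_eq_dualPairing hφ hρ (a := a) (b := 1) (c := a ^ m) (d := a ^ (m + 1))
      (by rw [mul_one, pow_succ']) (x := ⟨x, hx'⟩) (y := ⟨y, hy⟩) (x' := ⟨x, hx⟩)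
      (y' := ⟨a • y, hy'⟩) (one_smul _ x) rfl

lemma adjointInclusion_dualPairing_flip (hρ : ∀ c, ρ (Polynomial.C c) = algebraMap k _ c)
    (a : k[X]) :
    TateModule.AdjointInclusion (l := a) fun m => (dualPairing hφ hρ (a ^ m)).flip :=
  fun m y x hy hy' hx hx' =>
    dualPairing_eq_dualPairing hφ hρ (a := 1) (b := a) (c := a ^ m) (d := a ^ (m + 1))
      (by rw [one_mul, pow_succ]) (x := ⟨x, hx⟩) (y := ⟨y, hy'⟩) (x' := ⟨a • x, hx'⟩)
      (y' := ⟨y, hy⟩) rfl (one_smul _ y)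

/-- The torsion of `H ^ l` and the kernel of a matrix, as vector spaces over `k`. -/
def torsionKerEquiv [IsScalarTower k k[X] (Points ρ)] (a : k[X]) :
    Submodule.torsionBy k[X] (Points ρ) a ≃ₗ[k] LinearMap.ker (evalHom l φ (ρ a)) where
  toFun x := ⟨x.1, x.2⟩
  invFun x := ⟨x.1, x.2⟩
  left_inv _ := rfl
  right_inv _ := rfl
  map_add' _ _ := rfl
  map_smul' _ _ := rfl

lemma torsionBy_pow_zero {A M : Type*} [CommRing A] [AddCommGroup M] [Module A M] {a : A}
    (x : Submodule.torsionBy A M (a ^ 0)) : x = 0 :=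
  Subtype.ext <| (one_smul A x.1).symm.trans <|
    (congrArg (· • x.1) (pow_zero a).symm).trans ((Submodule.mem_torsionBy_iff _ _).1 x.2)

variable {hφ} in
lemma perfect_form [IsScalarTower k k[X] (Points ρ)] [IsScalarTower k k[X] (Points (starHom ρ))]
    {a : k[X]} (h : (poonenForm hφ (ρ a)).IsPerfPair) :
    ((∀ x, (∀ y, form hφ ρ a x y = 0) → x = 0) ∧
      ∀ f : Submodule.torsionBy k[X] (Points (starHom ρ)) a →ₗ[k] k,
        ∃ x, ∀ y, form hφ ρ a x y = f y) ∧
    ((∀ y, (∀ x, form hφ ρ a x y = 0) → y = 0) ∧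
      ∀ f : Submodule.torsionBy k[X] (Points ρ) a →ₗ[k] k, ∃ y, ∀ x, form hφ ρ a x y = f x) := by
  let e := torsionKerEquiv (ρ := ρ) a
  let e' := torsionKerEquiv (ρ := starHom ρ) a
  refine ⟨⟨fun x hx => ?_, fun f => ?_⟩, fun y hy => ?_, fun f => ?_⟩
  · refine e.injective (h.bijective_left.1 (LinearMap.ext fun y => ?_))
    rw [map_zero, map_zero]
    exact hx (e'.symm y)
  · obtain ⟨x, hx⟩ := h.bijective_left.2 (f ∘ₗ e'.symm.toLinearMap)
    exact ⟨e.symm x, fun y => congrArg (fun g => g (e' y)) hx⟩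
  · refine e'.injective (h.bijective_right.1 (LinearMap.ext fun x => ?_))
    exact (hy (e.symm x)).trans (map_zero (poonenForm hφ (ρ a) x)).symm
  · obtain ⟨y, hy⟩ := h.bijective_right.2 (f ∘ₗ e.symm.toLinearMap)
    exact ⟨e'.symm y, fun x => congrArg (fun g => g (e x)) hy⟩

/-- The pairing of the Tate modules is perfect if the Poonen pairings of all positive powers
are. -/
theorem isPerfPair_pairing (hρ : ∀ c, ρ (Polynomial.C c) = algebraMap k _ c) {a : k[X]}
    (h : ∀ m, 1 ≤ m → (poonenForm hφ (ρ (a ^ m))).IsPerfPair)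
    (Θ : TateModule a (PolyDual k) ≃ₗ[AdicRing a] AdicRing a) :
    ((TateModule.pairing (adjointInclusion_dualPairing hφ hρ a)).compr₂
      Θ.toLinearMap).IsPerfPair := by
  have := isScalarTower hρ
  have := isScalarTower (starHom_C hρ)
  have hp (m : ℕ) : ((∀ x, (∀ y, form hφ ρ (a ^ m) x y = 0) → x = 0) ∧
      ∀ f : Submodule.torsionBy k[X] (Points (starHom ρ)) (a ^ m) →ₗ[k] k,
        ∃ x, ∀ y, form hφ ρ (a ^ m) x y = f y) ∧
    ((∀ y, (∀ x, form hφ ρ (a ^ m) x y = 0) → y = 0) ∧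
      ∀ f : Submodule.torsionBy k[X] (Points ρ) (a ^ m) →ₗ[k] k,
        ∃ y, ∀ x, form hφ ρ (a ^ m) x y = f x) := by
    -- Perfectness is assumed for $m\ge1$ only; at level $0$ both torsion modules are zero.
    rcases Nat.eq_zero_or_pos m with rfl | hm
    · refine ⟨⟨fun x _ => torsionBy_pow_zero x, fun f => ⟨0, fun y => ?_⟩⟩,
        fun y _ => torsionBy_pow_zero y, fun f => ⟨0, fun x => ?_⟩⟩
      · rw [torsionBy_pow_zero y, map_zero]
        exact map_zero (poonenForm hφ (ρ (a ^ 0)) _)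
      · rw [torsionBy_pow_zero x, map_zero]
        exact map_zero (poonenForm hφ (ρ (a ^ 0)) _)
    · exact perfect_form (h m hm)
  refine TateModule.isPerfPair_pairing (adjointInclusion_dualPairing hφ hρ a)
    (adjointInclusion_dualPairing_flip hφ hρ a) (fun m => ?_) (fun m => ?_) Θ
  · simp only [dualPairing_apply_one]
    exact (hp m).1
  · simp only [dualPairing_apply_one]
    exact (hp m).2

/-- The values lie in $k$, on which $\Gamma$ is trivial, so the equivariance `poonen_map` becomes
invariance at each level. -/
lemma pairing_galois (hρ : ∀ c, ρ (Polynomial.C c) = algebraMap k _ c) (a : k[X])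
    (Γ : H →ₐ[k] H) (h1 : ∀ x, Γ (φ x) = φ (Γ x)) (h2 : ∀ x, Γ (φ.symm x) = φ.symm (Γ x))
    (h3 : ∀ a i j n, Γ (Tw.val ((ρ a i j).coeff n)) = Tw.val ((ρ a i j).coeff n))
    (h4 : ∀ a i j n, Γ (Tw.val ((starHom ρ a i j).coeff n)) = Tw.val ((starHom ρ a i j).coeff n))
    (x : TateModule a (Points ρ)) (y : TateModule a (Points (starHom ρ))) :
    TateModule.pairing (adjointInclusion_dualPairing hφ hρ a)
      (TateModule.map (galois ρ Γ h1 h3) x) (TateModule.map (galois (starHom ρ) Γ h2 h4) y) =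
    TateModule.pairing (adjointInclusion_dualPairing hφ hρ a) x y := by
  refine Subtype.ext <| funext fun m => DFunLike.ext _ _ fun b => (algebraMap k H).injective ?_
  rw [TateModule.pairing_apply, TateModule.pairing_apply, dualPairing_apply, dualPairing_apply,
    form, form, algebraMap_poonenForm, ← AlgHom.commutes Γ, algebraMap_poonenForm]
  refine poonen_map Γ h2 (h4 (a ^ m)) (fun i => ?_) fun i => rfl
  exact congrFun (map_smul (galois ρ Γ h1 h3) b (x.1 m)).symm i

end Points

end TwMat

/-! ### Application to Anderson $t$-modules -/

namespace AndersonModule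

variable {Fq : Type*} [Field Fq] [Fintype Fq] {F : Type*} [Field F] [Algebra Fq F]
  [Algebra.IsAlgebraic Fq F] {κ : ScalarKind} {n : ℕ} {θbar : F} {l : ℕ}
  (E : AndersonModule Fq κ n θbar l)

/-- This recovers the $k$-linearity that `baseChange`, being only a ring homomorphism, does not
carry. -/
lemma baseChange_C (c : FZ κ n Fq) : E.baseChange (Polynomial.C c) = algebraMap (FZ κ n Fq) _ c := by
  have h : E.toAlgHom (Polynomial.C c) = algebraMap (FZ κ n Fq) _ c := E.toAlgHom.commutes c
  ext1 i j
  change TwPoly.map _ (FZ.mapAlgHom_tau κ n Fq _) (E.toAlgHom (Polynomial.C c) i j) = _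
  rw [h, Matrix.algebraMap_matrix_apply, Matrix.algebraMap_matrix_apply]
  split_ifs
  · exact TwPoly.map_algebraMap _ _ c
  · exact map_zero _

/-- The Poonen pairings induce a continuous, Galois equivariant pairing of the Tate modules, which
is perfect if the torsion modules have full dimension. -/
theorem exists_tatePairing {lam : (FZ κ n Fq)[X]}
    (Θ : TateModule lam (PolyDual (FZ κ n Fq)) ≃ₗ[AdicRing lam] AdicRing lam) :
    ∃ B : E.tate lam →ₗ[AdicRing lam] E.adjointTate lam →ₗ[AdicRing lam] AdicRing lam,
      Continuous (fun p : E.tate lam × E.adjointTate lam => B p.1 p.2) ∧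
      (∀ (m : ℕ) (x : E.tate lam) (y : E.adjointTate lam) (a : (FZ κ n Fq)[X]),
        algebraMap (FZ κ n Fq) (FZ κ n (AlgebraicClosure F)) ((Θ.symm (B x y)).1 m a) =
          E.bracket (lam ^ m) (TateModule.proj m x) (TateModule.proj m y) a) ∧
      (∀ (γ : AlgebraicClosure F ≃ₐ[F] AlgebraicClosure F) (x : E.tate lam)
        (y : E.adjointTate lam),
        B (E.tateGalois lam γ x) (E.adjointTateGalois lam γ y) = B x y) ∧
      (E.TateConditions lam → B.IsPerfPair) := by
  have hφ : FixedFieldEq (FZ.tau κ n Fq (AlgebraicClosure F)) := FZ.fixedFieldEq_tau κ n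
  have hinf : ¬ FiniteDimensional (FZ κ n Fq) (FZ κ n (AlgebraicClosure F)) :=
    FZ.not_finiteDimensional κ n
  have hc := TwMat.Points.adjointInclusion_dualPairing hφ E.baseChange_C lam
  refine ⟨(TateModule.pairing hc).compr₂ Θ.toLinearMap,
    TateModule.continuous_pairing hc Θ.toLinearMap, fun m x y a => ?_, fun γ x y => ?_,
    fun h => ?_⟩
  · rw [LinearMap.compr₂_apply, LinearEquiv.coe_coe, Θ.symm_apply_apply, TateModule.pairing_apply]
    exact TwMat.Points.algebraMap_dualPairing hφ E.baseChange_C _ _ _ _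
  · rw [LinearMap.compr₂_apply, LinearMap.compr₂_apply]
    exact congrArg Θ (TwMat.Points.pairing_galois hφ E.baseChange_C lam (galoisH κ n γ)
      (galoisH_tau γ) (galoisH_tau_symm γ) (E.galoisH_baseChange γ) (E.galoisH_adjoint γ) x y)
  · exact TwMat.Points.isPerfPair_pairing hφ E.baseChange_C (fun m hm =>
      TwMat.isPerfPair_poonenForm hφ hinf (h.2 m hm).1 (h.2 m hm).2) Θ

end AndersonModule
end

theorem theorem3 (Fq : Type*) [Field Fq] [Fintype Fq] (f : Fq[X]) (hf : f.Monic)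
    [Fact (Irreducible f)] (θbar : AdjoinRoot f) (hθ : Polynomial.aeval θbar f = 0)
    (κ : ScalarKind) (n l : ℕ) (E : AndersonModule Fq κ n θbar l)
    (lam₀ : Fq[X]) (hmonic : lam₀.Monic) (hirr : Irreducible lam₀) (hne : lam₀ ≠ f)
    (lam : (FZ κ n Fq)[X]) (hlam : lam = lam₀.map (FZ.const κ n Fq)) :
    Nonempty (TateModule lam (PolyDual (FZ κ n Fq)) ≃ₗ[AdicRing lam] AdicRing lam) ∧
    ∀ Θ : TateModule lam (PolyDual (FZ κ n Fq)) ≃ₗ[AdicRing lam] AdicRing lam,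
      ∃ B : E.tate lam →ₗ[AdicRing lam] E.adjointTate lam →ₗ[AdicRing lam] AdicRing lam,
        Continuous (fun p : E.tate lam × E.adjointTate lam => B p.1 p.2) ∧
        (∀ (m : ℕ) (x : E.tate lam) (y : E.adjointTate lam) (a : (FZ κ n Fq)[X]),
          algebraMap (FZ κ n Fq) (FZ κ n (AlgebraicClosure (AdjoinRoot f)))
              ((Θ.symm (B x y)).1 m a) =
            E.bracket (lam ^ m) (TateModule.proj m x) (TateModule.proj m y) a) ∧
        (∀ (γ : AlgebraicClosure (AdjoinRoot f) ≃ₐ[AdjoinRoot f] AlgebraicClosure (AdjoinRoot f))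
          (x : E.tate lam) (y : E.adjointTate lam),
          B (E.tateGalois lam γ x) (E.adjointTateGalois lam γ y) = B x y) ∧
        (E.TateConditions lam → B.Nondegenerate ∧ B.IsPerfPair) := by
  have hlm : lam.Monic := hlam ▸ hmonic.map _
  have hld : 0 < lam.natDegree := by
    rw [hlam, Polynomial.natDegree_map]; exact hirr.natDegree_pos
  refine ⟨PolyDual.nonempty_tateModule_equiv hlm hld, fun Θ => ?_⟩
  obtain ⟨B, hB, hB', hB'', h⟩ := E.exists_tatePairing Θ
  refine ⟨B, hB, hB', hB'', fun hT => ?_⟩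
  have hp := h hT
  refine ⟨⟨fun x hx => ?_, fun y hy => ?_⟩, hp⟩
  · exact hp.bijective_left.1 ((LinearMap.ext hx).trans (map_zero B).symm)
  · exact hp.bijective_right.1 ((LinearMap.ext hy).trans (map_zero B.flip).symm)
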